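/- **Theorem 2.1.** Let $n\in\mathbb N$ and let $\varphi\in\mathcal S(\mathbb R^n)$ satisfy $\int\varphi(x)\,dx=1$ and $\int x^\alpha\varphi(x)\,dx=0$ for all $\alpha\in\mathbb N^n$, $\alpha\ne0$; put $\varphi_\epsilon(x)=\epsilon^{-n}\varphi(x/\epsilon)$ for $\epsilon\in(0,1]$, and $\langle x\rangle=(1+|x|^2)^{1/2}$. Consider families $(u_\epsilon)_{\epsilon\in(0,1]}$ of smooth functions $u_\epsilon:\mathbb R^n\to\mathbb C$. Let - $\mathcal E_\tau(\mathbb R^n)$ be the algebra of the families such that for all $\alpha\in\mathbb N^n$ there is $N\in\mathbb N$ with $\sup_{\epsilon\in(0,1]}\epsilon^N\|\langle x\rangle^{-N}\partial^\alpha u_\epsilon\|_{L^\infty(\mathbb R^n)}<\infty$; - $\mathcal N_{\mathcal S}(\mathbb R^n)$ be the ideal of the families such that $\sup_{\epsilon\in(0,1]}\epsilon^{-q}\|x^\alpha\partial^\beta u_\epsilon\|_{L^\infty(\mathbb R^n)}<\infty$ for all $\alpha,\beta\in\mathbb N^n$ and $q\in\mathbb N$; - $\mathcal G_{\tau,\mathcal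 S}(\mathbb R^n)=\mathcal E_\tau(\mathbb R^n)/\mathcal N_{\mathcal S}(\mathbb R^n)$; - $\mathcal G^\infty_{\mathcal S}(\mathbb R^n)$ be the set of the elements of $\mathcal G_{\tau,\mathcal S}(\mathbb R^n)$ that have a representative $(u_\epsilon)_\epsilon$ for which there is $N\in\mathbb N$ such that $\sup_{\epsilon\in(0,1]}\epsilon^{N}\|x^\alpha\partial^\beta u_\epsilon\|_{L^\infty(\mathbb R^n)}<\infty$ for all $\alpha,\beta\in\mathbb N^n$. Then the map $\imath:\mathcal S'(\mathbb R^n)\to\mathcal G_{\tau,\mathcal S}(\mathbb R^n)$, $\imath(w)=[(w*\varphi_\epsilon)_\epsilon]$, is injective, and $\imath(f)=[(f)_\epsilon]$ for all $f\in\mathcal S(\mathbb R^n)$. With $\mathcal S'(\mathbb R^n)$ and $\mathcal S(\mathbb R^n)$ identified with their images under $\imath$ in $\mathcal G_{\tau,\mathcal S}(\mathbb R^n)$, $$\mathcal G^\infty_{\mathcal S}(\mathbb R^n)\cap\mathcal S'(\mathbb R^n)=\mathcal S(\mathbb R^n).$$ -/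

import Mathlib

open scoped SchwartzMap

namespace Colombeau

open Filter Topology
open scoped ContDiff LineDeriv

/-! ### Basic notions -/

/-- Euclidean space `ℝⁿ`. -/
abbrev Rn (n : ℕ) : Type := EuclideanSpace ℝ (Fin n)

/-- The partial derivative in the `i`-th coordinate direction. -/
noncomputable def partialDeriv {n : ℕ} (i : Fin n) (f : Rn n → ℂ) : Rn n → ℂ :=
  fun x => lineDeriv ℝ f x (EuclideanSpace.single i 1)

/-- `∂^β f` for a multi-index `β`. -/
noncomputable def multiDeriv {n : ℕ} (β : Fin n → ℕ) (f : Rn n → ℂ) : Rn n → ℂ :=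
  (List.finRange n).foldr (fun i g => (partialDeriv i)^[β i] g) f

/-- `x^α` for a multi-index `α`. -/
noncomputable def monomial {n : ℕ} (α : Fin n → ℕ) (x : Rn n) : ℝ := ∏ i, x i ^ α i

/-- `⟨x⟩ = (1 + |x|²)^{1/2}`. -/
noncomputable def bracket {n : ℕ} (x : Rn n) : ℝ := Real.sqrt (1 + ‖x‖ ^ 2)

/-- Nets `(u_ε)_ε` of complex functions on `ℝⁿ`, indexed by `ε ∈ (0, 1]`. -/
abbrev Net (n : ℕ) : Type := Set.Ioc (0 : ℝ) 1 → Rn n → ℂ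

/-- Membership in `E[ℝⁿ]`: every `u_ε` is smooth. -/
def Net.IsSmooth {n : ℕ} (u : Net n) : Prop := ∀ ε, ContDiff ℝ ∞ (u ε)

/-- Membership in `E_τ(ℝⁿ)`: for all `α` there is `N` such that
`sup_ε ε^N ‖⟨x⟩^{-N} ∂^α u_ε‖_{L^∞} < ∞`. -/
def Net.IsModerate {n : ℕ} (u : Net n) : Prop :=
  u.IsSmooth ∧ ∀ α : Fin n → ℕ, ∃ (N : ℕ) (C : ℝ), ∀ (ε : Set.Ioc (0 : ℝ) 1) (x : Rn n),
    (ε : ℝ) ^ N * ((bracket x ^ N)⁻¹ * ‖multiDeriv α (u ε) x‖) ≤ C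

/-- Membership in `N_S(ℝⁿ)`: for all `α`, `β`, `q`,
`sup_ε ε^{-q} ‖x^α ∂^β u_ε‖_{L^∞} < ∞`. -/
def Net.IsNegligible {n : ℕ} (u : Net n) : Prop :=
  u.IsSmooth ∧ ∀ (α β : Fin n → ℕ) (q : ℕ), ∃ C : ℝ, ∀ (ε : Set.Ioc (0 : ℝ) 1) (x : Rn n),
    ((ε : ℝ) ^ q)⁻¹ * ‖monomial α x * multiDeriv β (u ε) x‖ ≤ C

/-- `S`-regular nets: there is `N` such that for all `α`, `β`,
`sup_ε ε^N ‖x^α ∂^β u_ε‖_{L^∞} < ∞`. -/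
def Net.IsRegular {n : ℕ} (u : Net n) : Prop :=
  u.IsSmooth ∧ ∃ N : ℕ, ∀ α β : Fin n → ℕ, ∃ C : ℝ, ∀ (ε : Set.Ioc (0 : ℝ) 1) (x : Rn n),
    (ε : ℝ) ^ N * ‖monomial α x * multiDeriv β (u ε) x‖ ≤ C

/-- A mollifier: a Schwartz function with integral one, all of whose higher moments vanish. -/
structure IsMollifier {n : ℕ} (φ : 𝓢(Rn n, ℂ)) : Prop where
  integral_eq_one : ∫ x, φ x = 1
  moment_eq_zero : ∀ α : Fin n → ℕ, α ≠ 0 → ∫ x, (monomial α x : ℂ) * φ x = 0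

/-- `φ_ε(x) = ε^{-n} φ(x / ε)`. -/
noncomputable def dilate {n : ℕ} (φ : 𝓢(Rn n, ℂ)) (ε : Set.Ioc (0 : ℝ) 1) : 𝓢(Rn n, ℂ) :=
  (((ε : ℝ) ^ n)⁻¹ : ℂ) • SchwartzMap.compCLMOfContinuousLinearEquiv ℂ
    (ContinuousLinearEquiv.smulLeft (Units.mk0 (ε : ℝ)⁻¹ (inv_ne_zero ε.2.1.ne'))) φ

theorem dilate_apply {n : ℕ} (φ : 𝓢(Rn n, ℂ)) (ε : Set.Ioc (0 : ℝ) 1) (x : Rn n) :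
    dilate φ ε x = (((ε : ℝ) ^ n)⁻¹ : ℂ) * φ ((ε : ℝ)⁻¹ • x) := by
  simp [dilate]

/-- The Schwartz function `y ↦ ψ(x - y)`. -/
noncomputable def reflTrans {n : ℕ} (x : Rn n) (ψ : 𝓢(Rn n, ℂ)) : 𝓢(Rn n, ℂ) :=
  SchwartzMap.compSubConstCLM ℂ x
    (SchwartzMap.compCLMOfContinuousLinearEquiv ℂ (ContinuousLinearEquiv.neg ℝ) ψ)

theorem reflTrans_apply {n : ℕ} (x : Rn n) (ψ : 𝓢(Rn n, ℂ)) (y : Rn n) :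
    reflTrans x ψ y = ψ (x - y) := by
  simp [reflTrans]

/-- The net `(w ∗ φ_ε)_ε`, where `(w ∗ ψ)(x) = ⟨w, ψ(x - ·)⟩`. -/
noncomputable def convNet {n : ℕ} (φ : 𝓢(Rn n, ℂ)) (w : 𝓢'(Rn n, ℂ)) : Net n :=
  fun ε x => w (reflTrans x (dilate φ ε))

/-! ### Smoothness of the convolution of a tempered distribution with a Schwartz function -/

theorem lineDeriv_comm {n : ℕ} (a b : Rn n) (R : 𝓢(Rn n, ℂ)) :
    (∂_{a} (∂_{b} R : 𝓢(Rn n, ℂ)) : 𝓢(Rn n, ℂ)) = ∂_{b} (∂_{a} R : 𝓢(Rn n, ℂ)) := by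
  ext y
  have hs : IsSymmSndFDerivAt ℝ R y :=
    (R.smooth ⊤).contDiffAt.isSymmSndFDerivAt (by
      rw [minSmoothness_of_isRCLikeNormedField]; exact WithTop.coe_le_coe.2 le_top)
  have hd : DifferentiableAt ℝ (fderiv ℝ R) y :=
    (((R.smooth ⊤).fderiv_right (m := 1) (by norm_cast)).differentiable (by simp)) y
  have key : ∀ u v : Rn n, (∂_{u} (∂_{v} R : 𝓢(Rn n, ℂ)) : 𝓢(Rn n, ℂ)) y
      = fderiv ℝ (fderiv ℝ R) y u v := by
    intro u v
    rw [SchwartzMap.lineDerivOp_apply_eq_fderiv]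
    have : (⇑(∂_{v} R : 𝓢(Rn n, ℂ)) : Rn n → ℂ) = fun z => fderiv ℝ R z v := by
      ext z; rfl
    rw [this, fderiv_clm_apply hd (by fun_prop)]
    simp
  rw [key, key, hs a b]

theorem iteratedLineDeriv_comm {n l : ℕ} (v : Fin l → Rn n) (h : Rn n) (R : 𝓢(Rn n, ℂ)) :
    (∂^{v} (∂_{h} R : 𝓢(Rn n, ℂ)) : 𝓢(Rn n, ℂ)) = ∂_{h} (∂^{v} R : 𝓢(Rn n, ℂ)) := by
  induction l with
  | zero => simp
  | succ l ih =>
    rw [LineDeriv.iteratedLineDerivOp_succ_left, LineDeriv.iteratedLineDerivOp_succ_left, ih,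
      lineDeriv_comm]

theorem iteratedFDeriv_lineDeriv {n : ℕ} (l : ℕ) (h : Rn n) (R : 𝓢(Rn n, ℂ)) (y : Rn n)
    (v : Fin l → Rn n) :
    iteratedFDeriv ℝ l (∂_{h} R : 𝓢(Rn n, ℂ)) y v = fderiv ℝ (iteratedFDeriv ℝ l R) y h v := by
  rw [← SchwartzMap.iteratedLineDerivOp_eq_iteratedFDeriv, iteratedLineDeriv_comm,
    SchwartzMap.lineDerivOp_apply_eq_fderiv]
  have : (⇑(∂^{v} R : 𝓢(Rn n, ℂ)) : Rn n → ℂ) = fun z => iteratedFDeriv ℝ l R z v := by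
    ext z; exact SchwartzMap.iteratedLineDerivOp_eq_iteratedFDeriv
  rw [this, fderiv_continuousMultilinear_apply_const]
  · rfl
  · exact (R.smooth ⊤).differentiable_iteratedFDeriv (mod_cast ENat.natCast_lt_top l) y

theorem norm_fderiv_iteratedFDeriv_sub {E : Type*} [NormedAddCommGroup E] [NormedSpace ℝ E]
    (R : E → ℂ) (l : ℕ) (z y : E) :
    ‖fderiv ℝ (iteratedFDeriv ℝ l R) z - fderiv ℝ (iteratedFDeriv ℝ l R) y‖ ≤
      ‖iteratedFDeriv ℝ (l + 1) R z - iteratedFDeriv ℝ (l + 1) R y‖ := by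
  refine ContinuousLinearMap.opNorm_le_bound _ (norm_nonneg _) fun h => ?_
  refine ContinuousMultilinearMap.opNorm_le_bound (by positivity) fun v => ?_
  have := (iteratedFDeriv ℝ (l + 1) R z - iteratedFDeriv ℝ (l + 1) R y).le_opNorm (Fin.cons h v)
  rw [sub_apply, iteratedFDeriv_succ_apply_left,
    iteratedFDeriv_succ_apply_left, Fin.prod_univ_succ] at this
  simpa [mul_assoc] using this

theorem taylor_seminorm {n : ℕ} (R : 𝓢(Rn n, ℂ)) (k l : ℕ) :
    ∃ K : ℝ, ∀ h : Rn n, ‖h‖ ≤ 1 →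
      SchwartzMap.seminorm ℂ k l
        (SchwartzMap.compSubConstCLM ℂ h R - R + (∂_{h} R : 𝓢(Rn n, ℂ))) ≤ K * ‖h‖ ^ 2 := by
  obtain ⟨K, hK0, hK⟩ : ∃ K : ℝ, 0 ≤ K ∧
      ∀ z : Rn n, (1 + ‖z‖) ^ k * ‖iteratedFDeriv ℝ (l + 2) R z‖ ≤ K := by
    refine ⟨_, ?_, fun z => SchwartzMap.one_add_le_sup_seminorm_apply (𝕜 := ℂ)
      (m := (k, l + 2)) le_rfl le_rfl R z⟩
    positivity
  refine ⟨2 ^ k * K, fun h hh => ?_⟩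
  refine SchwartzMap.seminorm_le_bound ℂ k l _ (by positivity) fun y => ?_
  set g := iteratedFDeriv ℝ l R with hg
  have hgs : ContDiff ℝ ∞ g := (R.smooth ⊤).iteratedFDeriv_right (by norm_cast)
  have hgd : Differentiable ℝ g := hgs.differentiable (by simp)
  have hgd2 : Differentiable ℝ (iteratedFDeriv ℝ (l + 1) R) :=
    (R.smooth ⊤).differentiable_iteratedFDeriv (mod_cast ENat.natCast_lt_top (l + 1))
  have hD : iteratedFDeriv ℝ l (SchwartzMap.compSubConstCLM ℂ h R - R + (∂_{h} R : 𝓢(Rn n, ℂ))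
      : 𝓢(Rn n, ℂ)) y = g (y - h) - g y - fderiv ℝ g y ((y - h) - y) := by
    have e : (⇑(SchwartzMap.compSubConstCLM ℂ h R - R + (∂_{h} R : 𝓢(Rn n, ℂ)) : 𝓢(Rn n, ℂ))
        : Rn n → ℂ) = ((fun z => R (z - h)) - ⇑R) + ⇑(∂_{h} R : 𝓢(Rn n, ℂ)) := by
      ext z; simp
    have c1 : ContDiff ℝ ∞ (fun z => R (z - h)) := (R.smooth ⊤).comp (by fun_prop)
    rw [e, iteratedFDeriv_add_apply, iteratedFDeriv_sub_apply, iteratedFDeriv_comp_sub]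
    · ext v
      simp [iteratedFDeriv_lineDeriv, hg]
    · exact (c1.of_le (mod_cast le_top)).contDiffAt
    · exact (R.smooth l).contDiffAt
    · exact ((c1.of_le (mod_cast le_top)).sub (R.smooth l)).contDiffAt
    · exact (SchwartzMap.smooth _ l).contDiffAt
  rw [hD]
  set A := 2 ^ k * K / (1 + ‖y‖) ^ k with hA
  have hA0 : 0 ≤ A := by positivity
  have h2 : ∀ z ∈ Metric.closedBall y ‖h‖, ‖fderiv ℝ (iteratedFDeriv ℝ (l + 1) R) z‖ ≤ A := by
    intro z hz
    rw [norm_fderiv_iteratedFDeriv, hA, le_div_iff₀ (by positivity)]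
    have hz' : ‖y‖ ≤ ‖z‖ + 1 := by
      have := norm_sub_norm_le y z
      rw [Metric.mem_closedBall, dist_comm, dist_eq_norm] at hz
      linarith
    calc _ ≤ ‖iteratedFDeriv ℝ (l + 2) R z‖ * (2 * (1 + ‖z‖)) ^ k := by
            gcongr; linarith [norm_nonneg z]
      _ = 2 ^ k * ((1 + ‖z‖) ^ k * ‖iteratedFDeriv ℝ (l + 2) R z‖) := by rw [mul_pow]; ring
      _ ≤ _ := by gcongr; exact hK z
  have hcb : Convex ℝ (Metric.closedBall y ‖h‖) := convex_closedBall _ _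
  have hy : y ∈ Metric.closedBall y ‖h‖ := Metric.mem_closedBall_self (norm_nonneg _)
  have hyh : y - h ∈ Metric.closedBall y ‖h‖ := by simp
  have h1 : ∀ z ∈ Metric.closedBall y ‖h‖, ‖fderiv ℝ g z - fderiv ℝ g y‖ ≤ A * ‖h‖ := by
    intro z hz
    refine (norm_fderiv_iteratedFDeriv_sub R l z y).trans ?_
    refine (hcb.norm_image_sub_le_of_norm_fderiv_le (fun x _ => hgd2 x) h2 hy hz).trans ?_
    gcongr
    simpa [dist_eq_norm] using hz
  have h0 := hcb.norm_image_sub_le_of_norm_fderiv_le' (fun x _ => hgd x) h1 hy hyh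
  have hnh : ‖y - h - y‖ = ‖h‖ := by simp
  rw [hnh] at h0
  calc _ ≤ ‖y‖ ^ k * (A * ‖h‖ * ‖h‖) := by gcongr
    _ ≤ (1 + ‖y‖) ^ k * (A * ‖h‖ * ‖h‖) := by gcongr; linarith
    _ = _ := by rw [hA]; field_simp

theorem exists_seminorm_bound {n : ℕ} (w : 𝓢'(Rn n, ℂ)) :
    ∃ (s : Finset (ℕ × ℕ)) (C : ℝ), 0 ≤ C ∧ ∀ g : 𝓢(Rn n, ℂ),
      ‖w g‖ ≤ C * ∑ p ∈ s, SchwartzMap.seminorm ℂ p.1 p.2 g := by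
  have hc : Continuous ((normSeminorm ℂ ℂ).comp (w : 𝓢(Rn n, ℂ) →ₗ[ℂ] ℂ)) := by
    change Continuous fun g => ‖w g‖
    exact (map_continuous w).norm
  obtain ⟨s, C, -, h⟩ := Seminorm.bound_of_continuous (schwartz_withSeminorms ℂ (Rn n) ℂ) _ hc
  refine ⟨s, C, C.2, fun g => ?_⟩
  refine (h g).trans ?_
  rw [smul_apply, NNReal.smul_def, smul_eq_mul]
  gcongr
  refine (Seminorm.finset_sup_le_sum _ s g).trans ?_
  rw [← FunLike.coeAddMonoidHom_apply, map_sum, Finset.sum_apply]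
  simp [schwartzSeminormFamily]

theorem hasFDerivAt_translate {n : ℕ} (w : 𝓢'(Rn n, ℂ)) (R : 𝓢(Rn n, ℂ)) :
    HasFDerivAt (fun x => w (SchwartzMap.compSubConstCLM ℂ x R))
      (LinearMap.toContinuousLinearMap (𝕜 := ℝ)
        { toFun := fun h : Rn n => - w (∂_{h} R : 𝓢(Rn n, ℂ))
          map_add' := fun a b => by
            have e : (∂_{a + b} R : 𝓢(Rn n, ℂ)) = ∂_{a} R + (∂_{b} R : 𝓢(Rn n, ℂ)) := by
              ext y
              simp [SchwartzMap.lineDerivOp_apply_eq_fderiv]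
            rw [e, map_add]; ring
          map_smul' := fun c a => by
            have e : (∂_{c • a} R : 𝓢(Rn n, ℂ)) = (c : ℂ) • (∂_{a} R : 𝓢(Rn n, ℂ)) := by
              ext y
              simp [SchwartzMap.lineDerivOp_apply_eq_fderiv]
            rw [e, map_smul]; simp }) 0 := by
  obtain ⟨s, C, hC, hb⟩ := exists_seminorm_bound w
  choose K hK using fun p : ℕ × ℕ => taylor_seminorm R p.1 p.2
  rw [hasFDerivAt_iff_isLittleO_nhds_zero]
  have hO : (fun h : Rn n => w (SchwartzMap.compSubConstCLM ℂ h R) - w R + w (∂_{h} R : 𝓢(Rn n, ℂ)))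
      =O[𝓝 0] fun h => ‖h‖ ^ 2 := by
    refine Asymptotics.IsBigO.of_bound (C * ∑ p ∈ s, K p) ?_
    filter_upwards [Metric.closedBall_mem_nhds (0 : Rn n) one_pos] with h hh
    have hh' : ‖h‖ ≤ 1 := by simpa using hh
    have e : w (SchwartzMap.compSubConstCLM ℂ h R) - w R + w (∂_{h} R : 𝓢(Rn n, ℂ))
        = w (SchwartzMap.compSubConstCLM ℂ h R - R + (∂_{h} R : 𝓢(Rn n, ℂ))) := by
      simp
    rw [e, norm_pow, norm_norm, mul_assoc, Finset.sum_mul]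
    refine (hb _).trans ?_
    gcongr with p hp
    exact hK p h hh'
  have ho : (fun h : Rn n => ‖h‖ ^ 2) =o[𝓝 0] fun h => h := by
    simpa using Asymptotics.isLittleO_norm_pow_id (E' := Rn n) (n := 2) (by norm_num)
  refine (hO.trans_isLittleO ho).congr_left fun h => ?_
  simp [sub_eq_add_neg]

theorem reflTrans_add {n : ℕ} (x h : Rn n) (ψ : 𝓢(Rn n, ℂ)) :
    reflTrans (x + h) ψ =
      SchwartzMap.compSubConstCLM ℂ h (reflTrans x ψ) := by
  ext y; simp [reflTrans_apply]; congr 1; abel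

theorem lineDeriv_reflTrans {n : ℕ} (x h : Rn n) (ψ : 𝓢(Rn n, ℂ)) :
    (∂_{h} (reflTrans x ψ) : 𝓢(Rn n, ℂ)) = - reflTrans x (∂_{h} ψ : 𝓢(Rn n, ℂ)) := by
  ext y
  rw [SchwartzMap.lineDerivOp_apply_eq_fderiv]
  have e : (⇑(reflTrans x ψ) : Rn n → ℂ) = fun y => ψ (x - y) := funext (reflTrans_apply x ψ)
  have h1 : HasFDerivAt (fun y => ψ (x - y))
      ((fderiv ℝ ψ (x - y)).comp (-ContinuousLinearMap.id ℝ (Rn n))) y :=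
    (ψ.differentiable (x - y)).hasFDerivAt.comp y ((hasFDerivAt_id y).const_sub x)
  rw [e, h1.fderiv]
  simp [reflTrans_apply, SchwartzMap.lineDerivOp_apply_eq_fderiv]

theorem hasFDerivAt_conv {n : ℕ} (w : 𝓢'(Rn n, ℂ)) (ψ : 𝓢(Rn n, ℂ)) (x : Rn n) :
    ∃ L : Rn n →L[ℝ] ℂ, HasFDerivAt (fun x => w (reflTrans x ψ)) L x ∧
      ∀ h, L h = w (reflTrans x (∂_{h} ψ : 𝓢(Rn n, ℂ))) := by
  have h0 := hasFDerivAt_translate w (reflTrans x ψ)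
  simp_rw [← reflTrans_add] at h0
  have h1 := (hasFDerivAt_comp_add_left (f := fun z => w (reflTrans z ψ)) (x := 0) x).1 h0
  rw [add_zero] at h1
  refine ⟨_, h1, fun h => ?_⟩
  simp [lineDeriv_reflTrans]

theorem fderiv_conv {n : ℕ} (w : 𝓢'(Rn n, ℂ)) (ψ : 𝓢(Rn n, ℂ)) (x h : Rn n) :
    fderiv ℝ (fun x => w (reflTrans x ψ)) x h = w (reflTrans x (∂_{h} ψ : 𝓢(Rn n, ℂ))) := by
  obtain ⟨L, hL, h'⟩ := hasFDerivAt_conv w ψ x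
  rw [hL.fderiv, h']

theorem contDiff_conv {n : ℕ} (w : 𝓢'(Rn n, ℂ)) (ψ : 𝓢(Rn n, ℂ)) :
    ContDiff ℝ ∞ (fun x => w (reflTrans x ψ)) := by
  rw [contDiff_infty]
  intro m
  have hd : ∀ ψ : 𝓢(Rn n, ℂ), Differentiable ℝ (fun x => w (reflTrans x ψ)) := fun ψ x =>
    (hasFDerivAt_conv w ψ x).choose_spec.1.differentiableAt
  induction m generalizing ψ with
  | zero => exact contDiff_zero.2 (hd ψ).continuous
  | succ m ih =>
    push_cast
    rw [contDiff_succ_iff_fderiv_apply]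
    refine ⟨hd ψ, fun h => by simp at h, fun y => ?_⟩
    simp_rw [fderiv_conv]
    exact ih _

/-! ### Calculus of partial derivatives -/

theorem partialDeriv_eq {n : ℕ} (i : Fin n) {f : Rn n → ℂ} (hf : ContDiff ℝ ∞ f) :
    partialDeriv i f = fun x => fderiv ℝ f x (EuclideanSpace.single i 1) := by
  ext x
  exact ((hf.differentiable (by simp)) x).lineDeriv_eq_fderiv

theorem contDiff_partialDeriv {n : ℕ} (i : Fin n) {f : Rn n → ℂ} (hf : ContDiff ℝ ∞ f) :
    ContDiff ℝ ∞ (partialDeriv i f) := by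
  rw [partialDeriv_eq i hf]
  exact (hf.fderiv_right (by norm_cast)).clm_apply contDiff_const

theorem partialDeriv_comm {n : ℕ} (i j : Fin n) {f : Rn n → ℂ} (hf : ContDiff ℝ ∞ f) :
    partialDeriv i (partialDeriv j f) = partialDeriv j (partialDeriv i f) := by
  have hd : Differentiable ℝ (fderiv ℝ f) :=
    (hf.fderiv_right (m := 1) (by norm_cast)).differentiable (by simp)
  have key : ∀ i j : Fin n, partialDeriv i (partialDeriv j f) = fun x =>
      fderiv ℝ (fderiv ℝ f) x (EuclideanSpace.single i 1) (EuclideanSpace.single j 1) := by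
    intro i j
    rw [partialDeriv_eq i (contDiff_partialDeriv j hf), partialDeriv_eq j hf]
    ext x
    rw [fderiv_clm_apply (hd x) (by fun_prop)]
    simp
  rw [key, key]
  ext x
  refine (hf.contDiffAt.isSymmSndFDerivAt ?_) _ _
  rw [minSmoothness_of_isRCLikeNormedField]; exact WithTop.coe_le_coe.2 le_top

theorem partialDeriv_add {n : ℕ} (i : Fin n) {f g : Rn n → ℂ} (hf : ContDiff ℝ ∞ f)
    (hg : ContDiff ℝ ∞ g) : partialDeriv i (f + g) = partialDeriv i f + partialDeriv i g := by
  rw [partialDeriv_eq i (f := f + g) (hf.add hg), partialDeriv_eq i hf, partialDeriv_eq i hg]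
  ext x
  rw [fderiv_add (hf.differentiable (by simp) x) (hg.differentiable (by simp) x)]
  rfl

theorem partialDeriv_mul {n : ℕ} (i : Fin n) {f g : Rn n → ℂ} (hf : ContDiff ℝ ∞ f)
    (hg : ContDiff ℝ ∞ g) :
    partialDeriv i (f * g) = partialDeriv i f * g + f * partialDeriv i g := by
  rw [partialDeriv_eq i (f := f * g) (hf.mul hg), partialDeriv_eq i hf, partialDeriv_eq i hg]
  ext x
  rw [fderiv_mul (hf.differentiable (by simp) x) (hg.differentiable (by simp) x)]
  simp
  ring

/-- Iterated partial derivatives along a list of coordinate directions. -/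
noncomputable def listDeriv {n : ℕ} (l : List (Fin n)) (f : Rn n → ℂ) : Rn n → ℂ :=
  l.foldr partialDeriv f

theorem contDiff_listDeriv {n : ℕ} (l : List (Fin n)) {f : Rn n → ℂ} (hf : ContDiff ℝ ∞ f) :
    ContDiff ℝ ∞ (listDeriv l f) := by
  induction l with
  | nil => exact hf
  | cons i l ih => exact contDiff_partialDeriv i ih

theorem listDeriv_append {n : ℕ} (l m : List (Fin n)) (f : Rn n → ℂ) :
    listDeriv (l ++ m) f = listDeriv l (listDeriv m f) := by
  simp [listDeriv]

theorem listDeriv_add {n : ℕ} (l : List (Fin n)) {f g : Rn n → ℂ} (hf : ContDiff ℝ ∞ f)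
    (hg : ContDiff ℝ ∞ g) : listDeriv l (f + g) = listDeriv l f + listDeriv l g := by
  induction l with
  | nil => rfl
  | cons i l ih =>
    change partialDeriv i (listDeriv l (f + g)) = _
    rw [ih, partialDeriv_add i (contDiff_listDeriv l hf) (contDiff_listDeriv l hg)]
    rfl

theorem listDeriv_perm {n : ℕ} {l m : List (Fin n)} (h : l.Perm m) {f : Rn n → ℂ}
    (hf : ContDiff ℝ ∞ f) : listDeriv l f = listDeriv m f := by
  induction h with
  | nil => rfl
  | cons i _ ih => exact congrArg (partialDeriv i) ih
  | swap i j l => exact partialDeriv_comm _ _ (contDiff_listDeriv l hf)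
  | trans _ _ h₁ h₂ => exact h₁.trans h₂

theorem multiDeriv_eq_listDeriv {n : ℕ} (β : Fin n → ℕ) (f : Rn n → ℂ) :
    multiDeriv β f = listDeriv ((List.finRange n).flatMap fun i => List.replicate (β i) i) f := by
  unfold multiDeriv
  generalize List.finRange n = L
  induction L with
  | nil => rfl
  | cons i L ih =>
    rw [List.foldr_cons, List.flatMap_cons, listDeriv_append, ih]
    generalize listDeriv _ f = g
    induction β i with
    | zero => rfl
    | succ k ihk =>
      rw [Function.iterate_succ_apply', ihk, List.replicate_succ]
      rfl

theorem listDeriv_eq_multiDeriv {n : ℕ} (l : List (Fin n)) {f : Rn n → ℂ}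
    (hf : ContDiff ℝ ∞ f) : listDeriv l f = multiDeriv (fun i => l.count i) f := by
  rw [multiDeriv_eq_listDeriv]
  refine listDeriv_perm (List.perm_iff_count.2 fun j => ?_) hf
  rw [List.count_flatMap]
  have : (List.count j ∘ fun i => List.replicate (List.count i l) i) =
      fun i => if i = j then List.count j l else 0 := by
    ext i
    by_cases h : i = j <;> simp [List.count_replicate, h]
  rw [this, ← List.ofFn_eq_map, List.sum_ofFn]
  simp

/-- Iterated partial derivatives of a net, taken for each value of the parameter. -/
noncomputable def netDeriv {n : ℕ} (l : List (Fin n)) (u : Net n) : Net n :=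
  fun ε => listDeriv l (u ε)

theorem forall_multiDeriv_iff {n : ℕ} {u : Net n} (hu : u.IsSmooth) (Q : Net n → Prop) :
    (∀ β : Fin n → ℕ, Q fun ε => multiDeriv β (u ε)) ↔ ∀ l, Q (netDeriv l u) := by
  constructor
  · intro h l
    have := h (fun i => l.count i)
    simp_rw [← listDeriv_eq_multiDeriv l (hu _)] at this
    exact this
  · intro h β
    simp_rw [multiDeriv_eq_listDeriv]
    exact h _

theorem netDeriv_mul {n : ℕ} (Q Q₁ Q₂ : Net n → Prop)
    (hadd : ∀ u v, Q u → Q v → Q (u + v)) (hmul : ∀ u v, Q₁ u → Q₂ v → Q (u * v))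
    (l : List (Fin n)) (u v : Net n) (hu : u.IsSmooth) (hv : v.IsSmooth)
    (h₁ : ∀ l, Q₁ (netDeriv l u)) (h₂ : ∀ l, Q₂ (netDeriv l v)) : Q (netDeriv l (u * v)) := by
  induction l using List.reverseRecOn generalizing u v with
  | nil => exact hmul u v (h₁ []) (h₂ [])
  | append_singleton l i ih =>
    have hu' : Net.IsSmooth (netDeriv [i] u) := fun ε => contDiff_partialDeriv i (hu ε)
    have hv' : Net.IsSmooth (netDeriv [i] v) := fun ε => contDiff_partialDeriv i (hv ε)
    have e : netDeriv (l ++ [i]) (u * v) =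
        netDeriv l (netDeriv [i] u * v) + netDeriv l (u * netDeriv [i] v) := by
      ext1 ε
      change listDeriv (l ++ [i]) (u ε * v ε) = listDeriv l (partialDeriv i (u ε) * v ε) +
        listDeriv l (u ε * partialDeriv i (v ε))
      rw [listDeriv_append, ← listDeriv_add l (f := partialDeriv i (u ε) * v ε)
        (g := u ε * partialDeriv i (v ε)) ((hu' ε).mul (hv ε)) ((hu ε).mul (hv' ε)), ← partialDeriv_mul i (hu ε) (hv ε)]
      rfl
    rw [e]
    refine hadd _ _ (ih _ _ hu' hv (fun m => ?_) h₂) (ih _ _ hu hv' h₁ fun m => ?_)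
    · have := h₁ (m ++ [i])
      unfold netDeriv at this
      simp_rw [listDeriv_append] at this
      exact this
    · have := h₂ (m ++ [i])
      unfold netDeriv at this
      simp_rw [listDeriv_append] at this
      exact this

theorem one_le_bracket {n : ℕ} (x : Rn n) : 1 ≤ bracket x := by
  rw [bracket, Real.one_le_sqrt]; nlinarith [sq_nonneg ‖x‖]

theorem bracket_sq {n : ℕ} (x : Rn n) : bracket x ^ 2 = 1 + ∑ i, x i ^ 2 := by
  rw [bracket, Real.sq_sqrt (by positivity), EuclideanSpace.norm_sq_eq]
  simp

theorem one_add_norm_le {n : ℕ} (x : Rn n) : 1 + ‖x‖ ≤ 2 * bracket x := by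
  have h : ‖x‖ ≤ bracket x := Real.le_sqrt_of_sq_le (by linarith)
  linarith [one_le_bracket x]

def ModBound {n : ℕ} (v : Net n) : Prop :=
  ∃ (N : ℕ) (C : ℝ), ∀ (ε : Set.Ioc (0 : ℝ) 1) (x : Rn n),
    (ε : ℝ) ^ N * ((bracket x ^ N)⁻¹ * ‖v ε x‖) ≤ C

def NegBound {n : ℕ} (v : Net n) : Prop :=
  ∀ (α : Fin n → ℕ) (q : ℕ), ∃ C : ℝ, ∀ (ε : Set.Ioc (0 : ℝ) 1) (x : Rn n),
    ((ε : ℝ) ^ q)⁻¹ * ‖monomial α x * v ε x‖ ≤ C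

theorem isModerate_iff {n : ℕ} (u : Net n) :
    u.IsModerate ↔ u.IsSmooth ∧ ∀ l, ModBound (netDeriv l u) :=
  and_congr_right fun hu => forall_multiDeriv_iff hu ModBound

theorem isNegligible_iff {n : ℕ} (u : Net n) :
    u.IsNegligible ↔ u.IsSmooth ∧ ∀ l, NegBound (netDeriv l u) :=
  and_congr_right fun hu => by
    rw [← forall_multiDeriv_iff hu NegBound]
    exact ⟨fun h β α => h α β, fun h α β => h β α⟩

theorem ModBound.add {n : ℕ} {u v : Net n} (hu : ModBound u) (hv : ModBound v) :
    ModBound (u + v) := by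
  obtain ⟨N, C, h⟩ := hu
  obtain ⟨M, D, h'⟩ := hv
  refine ⟨N + M, C + D, fun ε x => ?_⟩
  have hε := ε.2.1
  have hε1 := ε.2.2
  have hb := one_le_bracket x
  have hb0 : 0 < bracket x := by linarith
  have e1 : (ε : ℝ) ^ (N + M) ≤ ε ^ N := pow_le_pow_of_le_one hε.le hε1 (by omega)
  have e2 : (ε : ℝ) ^ (N + M) ≤ ε ^ M := pow_le_pow_of_le_one hε.le hε1 (by omega)
  have b1 : (bracket x ^ (N + M))⁻¹ ≤ (bracket x ^ N)⁻¹ := by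
    exact inv_anti₀ (by positivity) (pow_le_pow_right₀ hb (by omega))
  have b2 : (bracket x ^ (N + M))⁻¹ ≤ (bracket x ^ M)⁻¹ := by
    exact inv_anti₀ (by positivity) (pow_le_pow_right₀ hb (by omega))
  calc _ ≤ (ε : ℝ) ^ (N + M) * ((bracket x ^ (N + M))⁻¹ * (‖u ε x‖ + ‖v ε x‖)) := by
        gcongr; exact norm_add_le _ _
    _ = (ε : ℝ) ^ (N + M) * ((bracket x ^ (N + M))⁻¹ * ‖u ε x‖) +
        (ε : ℝ) ^ (N + M) * ((bracket x ^ (N + M))⁻¹ * ‖v ε x‖) := by ring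
    _ ≤ (ε : ℝ) ^ N * ((bracket x ^ N)⁻¹ * ‖u ε x‖) +
        (ε : ℝ) ^ M * ((bracket x ^ M)⁻¹ * ‖v ε x‖) := by gcongr
    _ ≤ _ := add_le_add (h ε x) (h' ε x)

theorem ModBound.mul {n : ℕ} {u v : Net n} (hu : ModBound u) (hv : ModBound v) :
    ModBound (u * v) := by
  obtain ⟨N, C, h⟩ := hu
  obtain ⟨M, D, h'⟩ := hv
  refine ⟨N + M, C * D, fun ε x => ?_⟩
  have hε := ε.2.1
  have hb0 : 0 < bracket x := by linarith [one_le_bracket x]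
  calc _ = ((ε : ℝ) ^ N * ((bracket x ^ N)⁻¹ * ‖u ε x‖)) *
        ((ε : ℝ) ^ M * ((bracket x ^ M)⁻¹ * ‖v ε x‖)) := by
        simp only [Pi.mul_apply, norm_mul, pow_add, mul_inv]; ring
    _ ≤ _ := mul_le_mul (h ε x) (h' ε x) (by positivity) (le_trans (by positivity) (h ε x))

theorem NegBound.add {n : ℕ} {u v : Net n} (hu : NegBound u) (hv : NegBound v) :
    NegBound (u + v) := by
  intro α q
  obtain ⟨C, h⟩ := hu α q
  obtain ⟨D, h'⟩ := hv α q
  refine ⟨C + D, fun ε x => ?_⟩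
  have hε := ε.2.1
  calc _ ≤ ((ε : ℝ) ^ q)⁻¹ * (‖monomial α x * u ε x‖ + ‖monomial α x * v ε x‖) := by
        gcongr
        simp only [Pi.add_apply, mul_add]
        exact norm_add_le _ _
    _ ≤ _ := by rw [mul_add]; exact add_le_add (h ε x) (h' ε x)

theorem NegBound.bracket {n : ℕ} {v : Net n} (hv : NegBound v) (k : ℕ) (α : Fin n → ℕ) (q : ℕ) :
    ∃ C : ℝ, ∀ (ε : Set.Ioc (0 : ℝ) 1) (x : Rn n),
      ((ε : ℝ) ^ q)⁻¹ * (bracket x ^ (2 * k) * ‖monomial α x * v ε x‖) ≤ C := by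
  induction k generalizing α with
  | zero => simpa using hv α q
  | succ k ih =>
    choose C hC using ih
    refine ⟨C α + ∑ i, C (α + Pi.single i 2), fun ε x => ?_⟩
    have hε := ε.2.1
    have hm : ∀ i, ‖(monomial (α + Pi.single i 2) x : ℂ) * v ε x‖ =
        x i ^ 2 * ‖monomial α x * v ε x‖ := by
      intro i
      have : monomial (α + Pi.single i 2) x = x i ^ 2 * monomial α x := by
        simp only [monomial, Pi.add_apply, pow_add, Finset.prod_mul_distrib]
        rw [mul_comm]
        congr 1
        rw [Finset.prod_eq_single i]
        · simp
        · intro j _ hj; simp [hj]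
        · simp
      rw [this]
      push_cast
      rw [mul_assoc, norm_mul, norm_pow, Complex.norm_real, Real.norm_eq_abs, sq_abs]
    calc _ = ((ε : ℝ) ^ q)⁻¹ * (Colombeau.bracket x ^ (2 * k) * ‖monomial α x * v ε x‖) +
          ∑ i, ((ε : ℝ) ^ q)⁻¹ * (Colombeau.bracket x ^ (2 * k) *
            ‖(monomial (α + Pi.single i 2) x : ℂ) * v ε x‖) := by
          simp_rw [hm]
          rw [mul_add, mul_one, pow_add, bracket_sq]
          simp_rw [← Finset.mul_sum, ← Finset.sum_mul]
          ring
      _ ≤ _ := by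
          gcongr with i hi
          · exact hC _ ε x
          · exact hC _ ε x

theorem ModBound.mul_neg {n : ℕ} {u v : Net n} (hu : ModBound u) (hv : NegBound v) :
    NegBound (u * v) := by
  intro α q
  obtain ⟨N, C, h⟩ := hu
  obtain ⟨D, h'⟩ := hv.bracket N α (q + N)
  refine ⟨C * D, fun ε x => ?_⟩
  have hε := ε.2.1
  have hb := one_le_bracket x
  have hb0 : 0 < Colombeau.bracket x := by linarith
  have hpow : Colombeau.bracket x ^ N ≤ Colombeau.bracket x ^ (2 * N) :=
    pow_le_pow_right₀ hb (by omega)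
  calc _ = ((ε : ℝ) ^ N * ((Colombeau.bracket x ^ N)⁻¹ * ‖u ε x‖)) *
        (((ε : ℝ) ^ (q + N))⁻¹ * (Colombeau.bracket x ^ N * ‖monomial α x * v ε x‖)) := by
        simp only [Pi.mul_apply, norm_mul, pow_add, mul_inv]
        field_simp
    _ ≤ ((ε : ℝ) ^ N * ((Colombeau.bracket x ^ N)⁻¹ * ‖u ε x‖)) *
        (((ε : ℝ) ^ (q + N))⁻¹ * (Colombeau.bracket x ^ (2 * N) * ‖monomial α x * v ε x‖)) := by
        gcongr
    _ ≤ _ := mul_le_mul (h ε x) (h' ε x) (by positivity) (le_trans (by positivity) (h ε x))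

theorem ModBound.of_bounded {n : ℕ} {v : Net n} (C : ℝ) (h : ∀ ε x, ‖v ε x‖ ≤ C) : ModBound v :=
  ⟨0, C, fun ε x => by simpa using h ε x⟩

/-! ### The algebra of generalized functions -/

theorem listDeriv_const {n : ℕ} (l : List (Fin n)) (c : ℂ) :
    ∃ d : ℂ, listDeriv l (fun _ => c) = fun _ => d := by
  induction l with
  | nil => exact ⟨c, rfl⟩
  | cons i l ih =>
    obtain ⟨d, hd⟩ := ih
    refine ⟨0, ?_⟩
    change partialDeriv i (listDeriv l _) = _
    rw [hd]
    ext x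
    simp [partialDeriv, lineDeriv]

/-- The algebra `E_τ(ℝⁿ)` of moderate nets, with pointwise operations. -/
noncomputable def moderate (n : ℕ) : Subalgebra ℂ (Net n) where
  carrier := {u | u.IsModerate}
  mul_mem' := by
    intro u v hu hv
    rw [Set.mem_ofPred_eq, isModerate_iff] at *
    exact ⟨fun ε => (hu.1 ε).mul (hv.1 ε), fun l => netDeriv_mul ModBound ModBound ModBound
      (fun _ _ => ModBound.add) (fun _ _ => ModBound.mul) l u v hu.1 hv.1 hu.2 hv.2⟩
  add_mem' := by
    intro u v hu hv
    rw [Set.mem_ofPred_eq, isModerate_iff] at *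
    refine ⟨fun ε => (hu.1 ε).add (hv.1 ε), fun l => ?_⟩
    have e : netDeriv l (u + v) = netDeriv l u + netDeriv l v := by
      ext1 ε; exact listDeriv_add l (hu.1 ε) (hv.1 ε)
    rw [e]
    exact (hu.2 l).add (hv.2 l)
  algebraMap_mem' := by
    intro c
    rw [Set.mem_ofPred_eq, isModerate_iff]
    refine ⟨fun ε => contDiff_const, fun l => ?_⟩
    obtain ⟨d, hd⟩ := listDeriv_const (n := n) l c
    refine ModBound.of_bounded ‖d‖ fun ε x => ?_
    change ‖listDeriv l (fun _ => c) x‖ ≤ _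
    rw [hd]

/-- The negligible nets `N_S(ℝⁿ)`, as an ideal of `E_τ(ℝⁿ)`. -/
noncomputable def negligible (n : ℕ) : Ideal (moderate n) where
  carrier := {u | (u : Net n).IsNegligible}
  add_mem' := by
    intro u v hu hv
    rw [Set.mem_ofPred_eq, isNegligible_iff] at *
    refine ⟨fun ε => (hu.1 ε).add (hv.1 ε), fun l => ?_⟩
    have e : netDeriv l ((u + v : moderate n) : Net n) = netDeriv l u + netDeriv l v := by
      ext1 ε; exact listDeriv_add l (hu.1 ε) (hv.1 ε)
    rw [e]
    exact (hu.2 l).add (hv.2 l)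
  zero_mem' := by
    rw [Set.mem_ofPred_eq, isNegligible_iff]
    refine ⟨fun ε => contDiff_const, fun l α q => ⟨0, fun ε x => ?_⟩⟩
    have h0 : listDeriv l (0 : Rn n → ℂ) = 0 := by
      have := listDeriv_add l (f := (0 : Rn n → ℂ)) (g := 0) contDiff_const contDiff_const
      simpa using this
    change _ * ‖_ * listDeriv l (0 : Rn n → ℂ) x‖ ≤ _
    simp [h0]
  smul_mem' := by
    intro u v hv
    have hu := (isModerate_iff _).1 u.2
    rw [Set.mem_ofPred_eq, isNegligible_iff] at *
    exact ⟨fun ε => (hu.1 ε).mul (hv.1 ε), fun l => netDeriv_mul NegBound ModBound NegBound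
      (fun _ _ => NegBound.add) (fun _ _ => ModBound.mul_neg) l u v hu.1 hv.1 hu.2 hv.2⟩

/-- The algebra of generalized functions `G_{τ,S}(ℝⁿ) = E_τ(ℝⁿ) / N_S(ℝⁿ)`. -/
abbrev GenFun (n : ℕ) : Type := moderate n ⧸ negligible n

/-- `G^∞_S(ℝⁿ)`: the generalized functions that have an `S`-regular representative. -/
def sRegular (n : ℕ) : Set (GenFun n) :=
  {U | ∃ u : moderate n, Ideal.Quotient.mk (negligible n) u = U ∧ (u : Net n).IsRegular}

/-! ### The embeddings -/

/-- Iterated partial derivatives along a list of directions, within the Schwartz space. -/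
noncomputable def listDerivS {n : ℕ} (l : List (Fin n)) (ψ : 𝓢(Rn n, ℂ)) : 𝓢(Rn n, ℂ) :=
  l.foldr (fun i g => (∂_{(EuclideanSpace.single i 1 : Rn n)} g : 𝓢(Rn n, ℂ))) ψ

theorem listDeriv_schwartz {n : ℕ} (l : List (Fin n)) (ψ : 𝓢(Rn n, ℂ)) :
    listDeriv l ψ = listDerivS l ψ := by
  induction l with
  | nil => rfl
  | cons i l ih =>
    change partialDeriv i (listDeriv l ψ) = _
    rw [ih, partialDeriv_eq i ((listDerivS l ψ).smooth ⊤)]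
    rfl

theorem listDeriv_conv {n : ℕ} (w : 𝓢'(Rn n, ℂ)) (l : List (Fin n)) (ψ : 𝓢(Rn n, ℂ)) :
    listDeriv l (fun x => w (reflTrans x ψ)) = fun x => w (reflTrans x (listDerivS l ψ)) := by
  induction l with
  | nil => rfl
  | cons i l ih =>
    change partialDeriv i (listDeriv l _) = _
    rw [ih, partialDeriv_eq i (contDiff_conv w _)]
    ext x
    exact fderiv_conv w _ x _

theorem norm_iteratedFDeriv_listDerivS {n : ℕ} (l : List (Fin n)) (ψ : 𝓢(Rn n, ℂ)) (m : ℕ)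
    (z : Rn n) :
    ‖iteratedFDeriv ℝ m (listDerivS l ψ) z‖ ≤ ‖iteratedFDeriv ℝ (m + l.length) ψ z‖ := by
  induction l generalizing m with
  | nil => rfl
  | cons i l ih =>
    have hs : ContDiff ℝ ∞ (fderiv ℝ (listDerivS l ψ)) :=
      ((listDerivS l ψ).smooth ⊤).fderiv_right (by norm_cast)
    have := norm_iteratedFDeriv_clm_apply_const (n := m) (x := z)
      (c := (EuclideanSpace.single i 1 : Rn n)) hs.contDiffAt (WithTop.coe_le_coe.2 le_top)
    rw [norm_iteratedFDeriv_fderiv, PiLp.norm_single, norm_one, one_mul] at this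
    refine (this.trans (ih (m + 1))).trans_eq ?_
    rw [List.length_cons]
    rw [show m + 1 + l.length = m + (l.length + 1) by omega]

theorem norm_iteratedFDeriv_dilate {n : ℕ} (φ : 𝓢(Rn n, ℂ)) (ε : Set.Ioc (0 : ℝ) 1) (j : ℕ)
    (z : Rn n) : ‖iteratedFDeriv ℝ j (dilate φ ε) z‖ =
      ((ε : ℝ) ^ (n + j))⁻¹ * ‖iteratedFDeriv ℝ j φ ((ε : ℝ)⁻¹ • z)‖ := by
  have hε := ε.2.1
  have e : (⇑(dilate φ ε) : Rn n → ℂ) = (((ε : ℝ) ^ n)⁻¹ : ℝ) • fun x => φ ((ε : ℝ)⁻¹ • x) := by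
    ext x
    simp [dilate_apply]
  have hc : ContDiff ℝ j (fun x => φ ((ε : ℝ)⁻¹ • x)) := (φ.smooth j).comp (by fun_prop)
  rw [e, iteratedFDeriv_const_smul_apply hc.contDiffAt, iteratedFDeriv_comp_const_smul _ (φ.smooth j),
    norm_smul, norm_smul, norm_inv, norm_pow, norm_pow, norm_inv, Real.norm_of_nonneg hε.le,
    pow_add, mul_inv, inv_pow, mul_assoc]

theorem seminorm_reflTrans {n : ℕ} (ψ : 𝓢(Rn n, ℂ)) (k m : ℕ) (K : ℝ)
    (hK : ∀ z, (1 + ‖z‖) ^ k * ‖iteratedFDeriv ℝ m ψ z‖ ≤ K) (x : Rn n) :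
    SchwartzMap.seminorm ℂ k m (reflTrans x ψ) ≤ (1 + ‖x‖) ^ k * K := by
  have hK0 : 0 ≤ K := le_trans (by positivity) (hK 0)
  refine SchwartzMap.seminorm_le_bound ℂ k m _ (by positivity) fun y => ?_
  have e : (⇑(reflTrans x ψ) : Rn n → ℂ) =
      fun y => (fun z => ψ (LinearIsometryEquiv.neg ℝ z)) (y - x) := by
    ext y; simp [reflTrans_apply]
  have e2 : ‖iteratedFDeriv ℝ m (reflTrans x ψ) y‖ = ‖iteratedFDeriv ℝ m ψ (x - y)‖ := by
    rw [e, iteratedFDeriv_comp_sub (f := fun z => ψ (LinearIsometryEquiv.neg ℝ z))]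
    have := (LinearIsometryEquiv.neg ℝ (E := Rn n)).norm_iteratedFDeriv_comp_right (⇑ψ) (y - x) m
    rw [Function.comp_def] at this
    rw [this]
    simp
  rw [e2]
  have hy : ‖y‖ ≤ (1 + ‖x‖) * (1 + ‖x - y‖) := by
    have := norm_sub_norm_le y x
    rw [norm_sub_rev] at this
    nlinarith [norm_nonneg x, norm_nonneg (x - y)]
  calc _ ≤ ((1 + ‖x‖) * (1 + ‖x - y‖)) ^ k * ‖iteratedFDeriv ℝ m ψ (x - y)‖ := by gcongr
    _ = (1 + ‖x‖) ^ k * ((1 + ‖x - y‖) ^ k * ‖iteratedFDeriv ℝ m ψ (x - y)‖) := by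
        rw [mul_pow]; ring
    _ ≤ _ := by gcongr; exact hK _

theorem convNet_isModerate {n : ℕ} (φ : 𝓢(Rn n, ℂ)) (w : 𝓢'(Rn n, ℂ)) :
    (convNet φ w).IsModerate := by
  rw [isModerate_iff]
  refine ⟨fun ε => contDiff_conv w _, fun l => ?_⟩
  obtain ⟨s, C, hC, hb⟩ := exists_seminorm_bound w
  have hφ : ∀ p : ℕ × ℕ, ∃ K : ℝ, ∀ z : Rn n,
      (1 + ‖z‖) ^ p.1 * ‖iteratedFDeriv ℝ p.2 φ z‖ ≤ K := fun p =>
    ⟨_, fun z => SchwartzMap.one_add_le_sup_seminorm_apply (𝕜 := ℂ) (m := p) le_rfl le_rfl φ z⟩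
  choose K hK using hφ
  set d := l.length
  set N := ∑ p ∈ s, (p.1 + n + p.2 + d) with hN
  refine ⟨N, C * ∑ p ∈ s, 2 ^ p.1 * K (p.1, p.2 + d), fun ε x => ?_⟩
  have hε := ε.2.1
  have hε1 := ε.2.2
  have hbr := one_le_bracket x
  have hbr0 : 0 < bracket x := by linarith
  have e : netDeriv l (convNet φ w) ε x = w (reflTrans x (listDerivS l (dilate φ ε))) :=
    congrFun (listDeriv_conv w l (dilate φ ε)) x
  have hK0 : ∀ p, 0 ≤ K p := fun p => le_trans (by positivity) (hK p 0)
  rw [e]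
  calc _ ≤ (ε : ℝ) ^ N * ((bracket x ^ N)⁻¹ * (C * ∑ p ∈ s,
        SchwartzMap.seminorm ℂ p.1 p.2 (reflTrans x (listDerivS l (dilate φ ε))))) := by
        gcongr; exact hb _
    _ = C * ∑ p ∈ s, (ε : ℝ) ^ N * ((bracket x ^ N)⁻¹ *
        SchwartzMap.seminorm ℂ p.1 p.2 (reflTrans x (listDerivS l (dilate φ ε)))) := by
        simp_rw [← Finset.mul_sum]; ring
    _ ≤ _ := by
        refine mul_le_mul_of_nonneg_left (Finset.sum_le_sum fun p hp => ?_) hC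
        have hpN : p.1 + n + p.2 + d ≤ N :=
          Finset.single_le_sum (f := fun p : ℕ × ℕ => p.1 + n + p.2 + d)
            (fun _ _ => Nat.zero_le _) hp
        have h1 : SchwartzMap.seminorm ℂ p.1 p.2 (reflTrans x (listDerivS l (dilate φ ε))) ≤
            (1 + ‖x‖) ^ p.1 * (((ε : ℝ) ^ (n + (p.2 + d)))⁻¹ * K (p.1, p.2 + d)) := by
          refine seminorm_reflTrans _ _ _ _ (fun z => ?_) x
          have hz : ‖z‖ ≤ ‖(ε : ℝ)⁻¹ • z‖ := by
            rw [norm_smul, norm_inv, Real.norm_of_nonneg hε.le]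
            exact le_mul_of_one_le_left (norm_nonneg _) (one_le_inv₀ hε |>.2 hε1)
          calc _ ≤ (1 + ‖(ε : ℝ)⁻¹ • z‖) ^ p.1 *
                ‖iteratedFDeriv ℝ (p.2 + d) (dilate φ ε) z‖ := by
                gcongr; exact norm_iteratedFDeriv_listDerivS l _ _ _
            _ = ((ε : ℝ) ^ (n + (p.2 + d)))⁻¹ * ((1 + ‖(ε : ℝ)⁻¹ • z‖) ^ p.1 *
                ‖iteratedFDeriv ℝ (p.2 + d) φ ((ε : ℝ)⁻¹ • z)‖) := by
                rw [norm_iteratedFDeriv_dilate]; ring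
            _ ≤ _ := by gcongr; exact hK (p.1, p.2 + d) _
        have hεp : (ε : ℝ) ^ N ≤ ε ^ (n + (p.2 + d)) :=
          pow_le_pow_of_le_one hε.le hε1 (by omega)
        have hbp : bracket x ^ p.1 ≤ bracket x ^ N := pow_le_pow_right₀ hbr (by omega)
        have hx := one_add_norm_le x
        calc _ ≤ (ε : ℝ) ^ N * ((bracket x ^ N)⁻¹ *
              ((2 * bracket x) ^ p.1 * (((ε : ℝ) ^ (n + (p.2 + d)))⁻¹ * K (p.1, p.2 + d)))) := by
              have := hK0 (p.1, p.2 + d)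
              refine mul_le_mul_of_nonneg_left (mul_le_mul_of_nonneg_left (h1.trans ?_)
                (by positivity)) (by positivity)
              gcongr
          _ = (2 ^ p.1 * K (p.1, p.2 + d)) * (((ε : ℝ) ^ N / (ε : ℝ) ^ (n + (p.2 + d))) *
              (bracket x ^ p.1 / bracket x ^ N)) := by
              rw [mul_pow]; ring
          _ ≤ (2 ^ p.1 * K (p.1, p.2 + d)) * (1 * 1) := by
              have := hK0 (p.1, p.2 + d)
              gcongr
              · exact (div_le_one (by positivity)).2 hεp
              · exact (div_le_one (by positivity)).2 hbp
          _ = _ := by ring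

theorem constNet_isModerate {n : ℕ} (f : 𝓢(Rn n, ℂ)) : Net.IsModerate (fun _ => ⇑f : Net n) := by
  rw [isModerate_iff]
  refine ⟨fun ε => f.smooth ⊤, fun l => ?_⟩
  refine ModBound.of_bounded (SchwartzMap.seminorm ℂ 0 0 (listDerivS l f)) fun ε x => ?_
  change ‖listDeriv l f x‖ ≤ _
  rw [listDeriv_schwartz]
  exact SchwartzMap.norm_le_seminorm ℂ _ x

/-- The map `w ↦ [(w ∗ φ_ε)_ε]` from `S'(ℝⁿ)` to `G_{τ,S}(ℝⁿ)`. -/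
noncomputable def embedTempered {n : ℕ} (φ : 𝓢(Rn n, ℂ)) : 𝓢'(Rn n, ℂ) →ₗ[ℂ] GenFun n :=
  (Ideal.Quotient.mkₐ ℂ (negligible n)).toLinearMap ∘ₗ
    { toFun := fun w => ⟨convNet φ w, convNet_isModerate φ w⟩
      map_add' := fun _ _ => rfl
      map_smul' := fun _ _ => rfl }

/-- The map `f ↦ [(f)_ε]` from `S(ℝⁿ)` to `G_{τ,S}(ℝⁿ)`, by constant nets. -/
noncomputable def embedSchwartz (n : ℕ) : 𝓢(Rn n, ℂ) →ₗ[ℂ] GenFun n :=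
  (Ideal.Quotient.mkₐ ℂ (negligible n)).toLinearMap ∘ₗ
    { toFun := fun f => ⟨fun _ => ⇑f, constNet_isModerate f⟩
      map_add' := fun _ _ => rfl
      map_smul' := fun _ _ => rfl }

end Colombeau

/-! Everything rests on one estimate: since all higher moments of `φ` vanish, `φ_ε * f - f` is
`O(ε^(q+1))` in each Schwartz seminorm, for every `q`, at the price of `q + 1` more derivatives of
`f` (`IsMollifier.exists_seminorm_conv_dilate_sub_le`). It is Taylor's formula under the integral:
the polynomial part integrates to `f x`, and the remainder carries the power of `ε`.

For `f` in `𝓢` the estimate says at once that `f * φ_ε` and the constant net differ by a negligible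
net. For a tempered `w`, duality (`integral_mul_convolution`) gives `∫ g (w * φ_ε) = w (g *
φ_ε(-·))`. The reflection of `φ` is again a mollifier, so this tends to `w g`, and a negligible net
forces `w = 0`.

For the intersection, a regular representative makes `F_ε = w * φ_ε` itself regular, hence Schwartz
with every seminorm `O(ε^(-N))`, where `N` does not depend on the seminorm. Both `φ_δ * F_ε` and
`φ_ε * F_δ` are `w` regularized twice, so `F_ε - F_δ = (φ_ε * F_δ - F_δ) - (φ_δ * F_ε - F_ε)`. The
estimate of order `q = N` bounds this by a constant times `ε^(N+1) δ^(-N) + δ^(N+1) ε^(-N)`, which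
is `O(ε)` when `δ = 2ε`. The losses of derivatives are harmless because `N` is uniform. Along `ε =
2^(-j)` the differences are summable in every seminorm, so the `F_ε` converge to a Schwartz
function, which must be `w`.

The duality formula exchanges `w` with an integral of Schwartz functions. As `w` is controlled by
finitely many seminorms, Hahn–Banach factors it through a Banach space of bounded functions, where
Bochner integration applies. -/

namespace Colombeau

open Filter Topology MeasureTheory
open scoped ContDiff LineDeriv BoundedContinuousFunction

/-! ### Convolution of Schwartz functions -/

/-- The convolution of two scalar Schwartz functions. -/
noncomputable def conv {n : ℕ} (g f : 𝓢(Rn n, ℂ)) : 𝓢(Rn n, ℂ) :=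
  SchwartzMap.convolution (ContinuousLinearMap.mul ℂ ℂ) g f

theorem conv_apply {n : ℕ} (g f : 𝓢(Rn n, ℂ)) (x : Rn n) :
    conv g f x = ∫ t, g t * f (x - t) := by
  rw [conv, SchwartzMap.convolution_apply]
  rfl

theorem conv_comm {n : ℕ} (g f : 𝓢(Rn n, ℂ)) : conv g f = conv f g := by
  rw [conv, ← SchwartzMap.convolution_flip, ContinuousLinearMap.flip_mul, conv]

/-- Lets the calculus of `w ∗ ψ` for tempered `w` be reused for the convolution of two Schwartz
functions. -/
theorem toTempered_reflTrans {n : ℕ} (g f : 𝓢(Rn n, ℂ)) (x : Rn n) :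
    SchwartzMap.toTemperedDistributionCLM (Rn n) ℂ volume g (reflTrans x f) = conv g f x := by
  simp [conv_apply, reflTrans_apply, mul_comm]

theorem lineDeriv_conv {n : ℕ} (g f : 𝓢(Rn n, ℂ)) (h : Rn n) :
    (∂_{h} (conv g f) : 𝓢(Rn n, ℂ)) = conv g (∂_{h} f : 𝓢(Rn n, ℂ)) := by
  ext x
  rw [SchwartzMap.lineDerivOp_apply_eq_fderiv, ← toTempered_reflTrans, ← fderiv_conv]
  simp_rw [toTempered_reflTrans]

theorem iteratedLineDeriv_conv {n l : ℕ} (g f : 𝓢(Rn n, ℂ)) (v : Fin l → Rn n) :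
    (∂^{v} (conv g f) : 𝓢(Rn n, ℂ)) = conv g (∂^{v} f : 𝓢(Rn n, ℂ)) := by
  induction l with
  | zero => simp
  | succ l ih =>
    rw [LineDeriv.iteratedLineDerivOp_succ_left, LineDeriv.iteratedLineDerivOp_succ_left, ih,
      lineDeriv_conv]

theorem norm_iteratedFDeriv_lineDeriv {n : ℕ} (h : Rn n) (f : 𝓢(Rn n, ℂ)) (m : ℕ) (z : Rn n) :
    ‖iteratedFDeriv ℝ m (∂_{h} f : 𝓢(Rn n, ℂ)) z‖ ≤ ‖h‖ * ‖iteratedFDeriv ℝ (m + 1) f z‖ := by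
  have hs : ContDiff ℝ ∞ (fderiv ℝ f) := (f.smooth ⊤).fderiv_right (by norm_cast)
  have := norm_iteratedFDeriv_clm_apply_const (n := m) (x := z) (c := h)
    hs.contDiffAt (WithTop.coe_le_coe.2 le_top)
  rwa [norm_iteratedFDeriv_fderiv] at this

theorem norm_iteratedFDeriv_iteratedLineDeriv {n l : ℕ} (v : Fin l → Rn n) (f : 𝓢(Rn n, ℂ))
    (m : ℕ) (z : Rn n) : ‖iteratedFDeriv ℝ m (∂^{v} f : 𝓢(Rn n, ℂ)) z‖ ≤
      (∏ i, ‖v i‖) * ‖iteratedFDeriv ℝ (m + l) f z‖ := by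
  induction l generalizing m with
  | zero => simp
  | succ l ih =>
    rw [LineDeriv.iteratedLineDerivOp_succ_left, Fin.prod_univ_succ]
    refine (norm_iteratedFDeriv_lineDeriv _ _ _ _).trans ?_
    refine (mul_le_mul_of_nonneg_left (ih (Fin.tail v) (m + 1)) (norm_nonneg _)).trans_eq ?_
    rw [show m + 1 + l = m + (l + 1) by omega, mul_assoc]
    rfl

/-! ### Approximation of a Schwartz function by its mollifications -/

/-- One-variable Taylor formula for `t ↦ f (x + t • h)` on the unit interval, whose `m`-th
derivative is the `m`-th Fréchet derivative evaluated on the diagonal at `h`. -/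
theorem norm_sub_taylor_le {n : ℕ} {f : Rn n → ℂ} (hf : ContDiff ℝ ∞ f) (q : ℕ) (x h : Rn n)
    {C : ℝ} (hC : ∀ t ∈ Set.Icc (0 : ℝ) 1, ‖iteratedFDeriv ℝ (q + 1) f (x + t • h)‖ ≤ C) :
    ‖f (x + h) - ∑ m ∈ Finset.range (q + 1),
      ((m.factorial : ℝ)⁻¹ : ℝ) • iteratedFDeriv ℝ m f x (fun _ => h)‖ ≤ C * ‖h‖ ^ (q + 1) := by
  have hC0 : 0 ≤ C := (norm_nonneg _).trans (hC 0 (by simp))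
  set g : ℝ → ℂ := fun t => f (x + t • h) with hg
  have hgs : ContDiff ℝ ∞ g := hf.comp (by fun_prop)
  have hd : ∀ m : ℕ, ∀ t : ℝ, iteratedDeriv m g t =
      iteratedFDeriv ℝ m f (x + t • h) (fun _ => h) := by
    intro m
    induction m with
    | zero => intro t; simp [hg]
    | succ m ih =>
      intro t
      rw [iteratedDeriv_succ, funext ih, iteratedFDeriv_succ_apply_left]
      have h1 : HasFDerivAt (iteratedFDeriv ℝ m f)
          (fderiv ℝ (iteratedFDeriv ℝ m f) (x + t • h)) (x + t • h) :=
        (hf.differentiable_iteratedFDeriv (mod_cast ENat.natCast_lt_top m) _).hasFDerivAt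
      have h2 : HasDerivAt (fun t : ℝ => x + t • h) h t := by
        simpa using ((hasDerivAt_id t).smul_const h).const_add x
      have h3 := h1.comp_hasDerivAt t h2
      have h4 := (ContinuousMultilinearMap.apply ℝ (fun _ : Fin m => Rn n) ℂ
        (fun _ => h)).hasFDerivAt.comp_hasDerivAt t h3
      exact h4.deriv
  have hw : ∀ m : ℕ, ∀ t ∈ Set.Icc (0 : ℝ) 1, iteratedDerivWithin m g (Set.Icc 0 1) t =
      iteratedFDeriv ℝ m f (x + t • h) (fun _ => h) := by
    intro m t ht
    rw [iteratedDerivWithin_eq_iteratedDeriv (uniqueDiffOn_Icc zero_lt_one)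
      (hgs.of_le (mod_cast le_top)).contDiffAt ht, hd]
  have key := taylor_mean_remainder_bound (f := g) (n := q) (C := C * ‖h‖ ^ (q + 1)) zero_le_one
    (hgs.of_le (mod_cast le_top)).contDiffOn (Set.right_mem_Icc.2 zero_le_one) fun t ht => by
      rw [hw _ t ht]
      refine (ContinuousMultilinearMap.le_opNorm _ _).trans ?_
      simp only [Finset.prod_const, Finset.card_univ, Fintype.card_fin]
      gcongr
      exact hC t ht
  rw [taylor_within_apply] at key
  have h0 : (0 : ℝ) ∈ Set.Icc (0 : ℝ) 1 := by simp
  simp_rw [hw _ 0 h0] at key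
  simp only [hg, one_smul, sub_zero, one_pow, mul_one, zero_smul, add_zero] at key
  -- The factor `1 / q!` in the remainder is discarded.
  refine key.trans (div_le_self (by positivity) ?_)
  exact_mod_cast Nat.one_le_iff_ne_zero.2 q.factorial_ne_zero

/-! ### Moments of a mollifier against multilinear forms. -/

theorem norm_monomial_le {n : ℕ} (α : Fin n → ℕ) (x : Rn n) :
    ‖(monomial α x : ℂ)‖ ≤ ‖x‖ ^ ∑ i, α i := by
  rw [Complex.norm_real, monomial, norm_prod, ← Finset.prod_pow_eq_pow_sum]
  gcongr with i
  rw [norm_pow]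
  gcongr
  exact PiLp.norm_apply_le x i

theorem monomial_card_fiber {n m : ℕ} (s : Fin m → Fin n) (y : Rn n) :
    monomial (fun j => (Finset.univ.filter fun i => s i = j).card) y = ∏ i, y (s i) := by
  rw [monomial, ← Finset.prod_fiberwise_of_maps_to (s := Finset.univ) (t := Finset.univ) (g := s)
    (fun _ _ => Finset.mem_univ _)]
  refine Finset.prod_congr rfl fun j _ => ?_
  rw [← Finset.prod_const]
  exact Finset.prod_congr rfl fun i hi => by rw [(Finset.mem_filter.1 hi).2]

theorem integrable_monomial_mul {n : ℕ} (φ : 𝓢(Rn n, ℂ)) (α : Fin n → ℕ) :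
    Integrable (fun x => (monomial α x : ℂ) * φ x) := by
  refine (φ.integrable_pow_mul volume (∑ i, α i)).mono' ?_ (ae_of_all _ fun x => ?_)
  · refine Continuous.aestronglyMeasurable ?_
    unfold monomial
    fun_prop
  · rw [norm_mul]
    gcongr
    exact norm_monomial_le α x

/-- Expansion of `y` in the standard basis. It turns the coordinate-free Taylor terms into the
monomials in which the moment conditions are stated; a choice `s` of basis vectors has as
multi-index the sizes of its fibres. -/
theorem multilinear_diag_eq_sum {n m : ℕ} (M : ContinuousMultilinearMap ℝ (fun _ : Fin m => Rn n) ℂ)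
    (y : Rn n) : M (fun _ => y) = ∑ s : Fin m → Fin n,
      (monomial (fun j => (Finset.univ.filter fun i => s i = j).card) y : ℂ) *
        M (fun i => EuclideanSpace.single (s i) 1) := by
  have hy : y = ∑ j, y j • (EuclideanSpace.single j 1 : Rn n) := by
    have := (EuclideanSpace.basisFun (Fin n) ℝ).sum_repr y
    simpa using this.symm
  conv_lhs => rw [hy]
  rw [ContinuousMultilinearMap.map_sum]
  refine Finset.sum_congr rfl fun s _ => ?_
  rw [ContinuousMultilinearMap.map_smul_univ, Complex.real_smul, monomial_card_fiber]

theorem integrable_mul_multilinear_diag {n m : ℕ} (φ : 𝓢(Rn n, ℂ))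
    (M : ContinuousMultilinearMap ℝ (fun _ : Fin m => Rn n) ℂ) :
    Integrable (fun y => φ y * M (fun _ => y)) := by
  simp_rw [multilinear_diag_eq_sum, Finset.mul_sum]
  refine integrable_finsetSum _ fun s _ => ?_
  have := (integrable_monomial_mul φ (fun j => (Finset.univ.filter fun i => s i = j).card)).mul_const
    (M fun i => EuclideanSpace.single (s i) 1)
  refine this.congr (ae_of_all _ fun y => ?_)
  ring

theorem IsMollifier.integral_mul_multilinear_diag {n m : ℕ} {φ : 𝓢(Rn n, ℂ)} (hφ : IsMollifier φ)
    (hm : m ≠ 0) (M : ContinuousMultilinearMap ℝ (fun _ : Fin m => Rn n) ℂ) :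
    ∫ y, φ y * M (fun _ => y) = 0 := by
  have e : ∀ y, φ y * M (fun _ => y) = ∑ s : Fin m → Fin n,
      (monomial (fun j => (Finset.univ.filter fun i => s i = j).card) y * φ y) *
        M (fun i => EuclideanSpace.single (s i) 1) := by
    intro y
    rw [multilinear_diag_eq_sum, Finset.mul_sum]
    exact Finset.sum_congr rfl fun s _ => by ring
  simp_rw [e]
  rw [integral_finsetSum _ fun s _ => (integrable_monomial_mul φ _).mul_const _]
  refine Finset.sum_eq_zero fun s _ => ?_
  rw [integral_mul_const, hφ.moment_eq_zero, zero_mul]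
  -- As `m ≠ 0`, the index `s 0` occurs at least once, so the multi-index is nonzero.
  intro h
  have := congrFun h (s ⟨0, Nat.pos_of_ne_zero hm⟩)
  simp only [Pi.zero_apply, Finset.card_eq_zero, Finset.filter_eq_empty_iff] at this
  exact this (Finset.mem_univ ⟨0, Nat.pos_of_ne_zero hm⟩) rfl

theorem conv_dilate_apply {n : ℕ} (φ f : 𝓢(Rn n, ℂ)) (ε : Set.Ioc (0 : ℝ) 1) (x : Rn n) :
    conv (dilate φ ε) f x = ∫ y, φ y * f (x - (ε : ℝ) • y) := by
  have hε := ε.2.1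
  rw [conv_apply]
  have := Measure.integral_comp_inv_smul_of_nonneg (μ := (volume : Measure (Rn n)))
    (fun y => φ y * f (x - (ε : ℝ) • y)) hε.le
  have h2 : ∀ t, dilate φ ε t * f (x - t) = ((((ε : ℝ) ^ n)⁻¹ : ℝ) : ℂ) *
      (φ ((ε : ℝ)⁻¹ • t) * f (x - (ε : ℝ) • (ε : ℝ)⁻¹ • t)) := by
    intro t
    rw [dilate_apply, smul_inv_smul₀ hε.ne', mul_assoc]
    push_cast
    rfl
  simp_rw [h2]
  rw [integral_const_mul, this, finrank_euclideanSpace_fin, Complex.real_smul, ← mul_assoc,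
    ← Complex.ofReal_mul, inv_mul_cancel₀ (by positivity), Complex.ofReal_one, one_mul]

theorem integrable_one_add_norm_pow_mul {n : ℕ} (φ : 𝓢(Rn n, ℂ)) (k : ℕ) :
    Integrable (fun y => (1 + ‖y‖) ^ k * ‖φ y‖) := by
  refine ((((φ.integrable_pow_mul volume 0).add (φ.integrable_pow_mul volume k)).const_mul
    (2 ^ k : ℝ))).mono' (Continuous.aestronglyMeasurable (by fun_prop)) (ae_of_all _ fun y => ?_)
  rw [Real.norm_of_nonneg (by positivity)]
  have : (1 + ‖y‖) ^ k ≤ 2 ^ k * (1 + ‖y‖ ^ k) := by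
    rcases le_total ‖y‖ 1 with h | h
    · calc (1 + ‖y‖) ^ k ≤ 2 ^ k := by gcongr; linarith
        _ ≤ _ := le_mul_of_one_le_right (by positivity) (by simp)
    · calc (1 + ‖y‖) ^ k ≤ (2 * ‖y‖) ^ k := by gcongr; linarith
        _ = 2 ^ k * ‖y‖ ^ k := mul_pow _ _ _
        _ ≤ _ := by gcongr; linarith
  calc _ ≤ 2 ^ k * (1 + ‖y‖ ^ k) * ‖φ y‖ := by gcongr
    _ = _ := by simp; ring

/-- After rescaling, `φ_ε * f` at `x` is `∫ φ y * f (x - ε y)`. The Taylor polynomial `T` of degree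
`q` integrates against `φ` to `f x`, so only the remainder is left; the powers of `1 + ‖y‖` it
brings are absorbed by the decay of `φ`. -/
theorem IsMollifier.norm_conv_dilate_sub_le {n : ℕ} {φ : 𝓢(Rn n, ℂ)} (hφ : IsMollifier φ)
    (k q : ℕ) (f : 𝓢(Rn n, ℂ)) (ε : Set.Ioc (0 : ℝ) 1) {A : ℝ}
    (hA : ∀ z, (1 + ‖z‖) ^ k * ‖iteratedFDeriv ℝ (q + 1) f z‖ ≤ A) (x : Rn n) :
    (1 + ‖x‖) ^ k * ‖conv (dilate φ ε) f x - f x‖ ≤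
      (∫ y, (1 + ‖y‖) ^ (k + (q + 1)) * ‖φ y‖) * (ε : ℝ) ^ (q + 1) * A := by
  have hε := ε.2.1
  have hε1 := ε.2.2
  set T : Rn n → ℂ := fun y => ∑ m ∈ Finset.range (q + 1),
      ((m.factorial : ℝ)⁻¹ : ℝ) • iteratedFDeriv ℝ m f x (fun _ => -((ε : ℝ) • y)) with hT
  have hTe : ∀ y, φ y * T y = ∑ m ∈ Finset.range (q + 1),
      (((m.factorial : ℝ)⁻¹ * (-(ε : ℝ)) ^ m : ℝ) : ℂ) *
        (φ y * iteratedFDeriv ℝ m f x (fun _ => y)) := by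
    intro y
    rw [hT, Finset.mul_sum]
    refine Finset.sum_congr rfl fun m _ => ?_
    have : iteratedFDeriv ℝ m f x (fun _ => -((ε : ℝ) • y)) =
        ((-(ε : ℝ)) ^ m : ℝ) • iteratedFDeriv ℝ m f x (fun _ => y) := by
      have := (iteratedFDeriv ℝ m f x).map_smul_univ (fun _ => -(ε : ℝ)) (fun _ => y)
      simpa using this
    rw [this, Complex.real_smul, Complex.real_smul]
    push_cast
    ring
  have hTi : Integrable (fun y => φ y * T y) := by
    simp_rw [hTe]
    exact integrable_finsetSum _ fun m _ => (integrable_mul_multilinear_diag φ _).const_mul _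
  have hTint : ∫ y, φ y * T y = f x := by
    simp_rw [hTe]
    rw [integral_finsetSum _ fun m _ => (integrable_mul_multilinear_diag φ _).const_mul _,
      Finset.sum_eq_single 0]
    · simp [integral_mul_const, hφ.integral_eq_one]
    · intro m _ hm
      rw [integral_const_mul, hφ.integral_mul_multilinear_diag hm, mul_zero]
    · simp
  have hfi : Integrable (fun y => φ y * f (x - (ε : ℝ) • y)) := by
    refine φ.integrable.mul_bdd (c := SchwartzMap.seminorm ℂ 0 0 f)
      (Continuous.aestronglyMeasurable (f.continuous.comp (by fun_prop))) (ae_of_all _ fun y => ?_)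
    exact SchwartzMap.norm_le_seminorm ℂ f _
  have hdiff : conv (dilate φ ε) f x - f x = ∫ y, φ y * (f (x - (ε : ℝ) • y) - T y) := by
    rw [conv_dilate_apply]
    conv_lhs => rw [← hTint, ← integral_sub hfi hTi]
    simp_rw [mul_sub]
  have hpt : ∀ y, (1 + ‖x‖) ^ k * ‖φ y * (f (x - (ε : ℝ) • y) - T y)‖ ≤
      ((1 + ‖y‖) ^ (k + (q + 1)) * ‖φ y‖) * ((ε : ℝ) ^ (q + 1) * A) := by
    intro y
    have hA0 : 0 ≤ A := le_trans (by positivity) (hA 0)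
    have hb := norm_sub_taylor_le (f.smooth ⊤) q x (-((ε : ℝ) • y))
      (C := (1 + ‖y‖) ^ k * A / (1 + ‖x‖) ^ k) (fun t ht => by
        rw [le_div_iff₀ (by positivity)]
        set z := x + t • -((ε : ℝ) • y) with hz
        -- Peetre-type inequality: the weight at `x` is moved to the point `z` of the Taylor
        -- segment, at the cost of a weight in `y`.
        have hxz : 1 + ‖x‖ ≤ (1 + ‖y‖) * (1 + ‖z‖) := by
          have e : x = z + (t * ε) • y := by rw [hz, mul_smul]; simp
          have h1 : ‖(t * (ε : ℝ)) • y‖ ≤ ‖y‖ := by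
            rw [norm_smul, Real.norm_of_nonneg (mul_nonneg ht.1 hε.le)]
            exact mul_le_of_le_one_left (norm_nonneg _) (mul_le_one₀ ht.2 hε.le hε1)
          have h2 := norm_add_le z ((t * (ε : ℝ)) • y)
          rw [← e] at h2
          nlinarith [norm_nonneg y, norm_nonneg z]
        calc _ ≤ ‖iteratedFDeriv ℝ (q + 1) f z‖ * ((1 + ‖y‖) * (1 + ‖z‖)) ^ k := by gcongr
          _ = (1 + ‖y‖) ^ k * ((1 + ‖z‖) ^ k * ‖iteratedFDeriv ℝ (q + 1) f z‖) := by
            rw [mul_pow]; ring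
          _ ≤ _ := by gcongr; exact hA z)
    rw [← sub_eq_add_neg, norm_neg, norm_smul, Real.norm_of_nonneg hε.le] at hb
    rw [norm_mul]
    calc _ ≤ (1 + ‖x‖) ^ k * (‖φ y‖ *
          ((1 + ‖y‖) ^ k * A / (1 + ‖x‖) ^ k * ((ε : ℝ) * ‖y‖) ^ (q + 1))) := by gcongr
      _ = ((1 + ‖y‖) ^ k * ‖y‖ ^ (q + 1) * ‖φ y‖) * ((ε : ℝ) ^ (q + 1) * A) := by
          rw [mul_pow]
          field_simp
      _ ≤ _ := by
          rw [pow_add _ k]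
          have : ‖y‖ ≤ 1 + ‖y‖ := by linarith
          gcongr
  rw [hdiff, mul_assoc, ← integral_mul_const]
  calc _ ≤ (1 + ‖x‖) ^ k * ∫ y, ‖φ y * (f (x - (ε : ℝ) • y) - T y)‖ := by
        gcongr; exact norm_integral_le_integral_norm _
    _ = ∫ y, (1 + ‖x‖) ^ k * ‖φ y * (f (x - (ε : ℝ) • y) - T y)‖ := (integral_const_mul _ _).symm
    _ ≤ _ := integral_mono_of_nonneg (ae_of_all _ fun y => by positivity)
        ((integrable_one_add_norm_pow_mul φ _).mul_const _) (ae_of_all _ hpt)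

/-- Derivatives pass through the convolution, so the pointwise estimate applies to each `∂^{v} f`.
The constant is independent of `f`, which is essential later, when `f` itself varies with the scale.
-/
theorem IsMollifier.exists_seminorm_conv_dilate_sub_le {n : ℕ} {φ : 𝓢(Rn n, ℂ)}
    (hφ : IsMollifier φ) (k l q : ℕ) : ∃ C : ℝ, 0 ≤ C ∧
      ∀ (f : 𝓢(Rn n, ℂ)) (ε : Set.Ioc (0 : ℝ) 1),
        SchwartzMap.seminorm ℂ k l (conv (dilate φ ε) f - f) ≤ C * (ε : ℝ) ^ (q + 1) *
          ((Finset.Iic (k, q + 1 + l)).sup fun p => SchwartzMap.seminorm ℂ p.1 p.2) f := by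
  refine ⟨(∫ y, (1 + ‖y‖) ^ (k + (q + 1)) * ‖φ y‖) * 2 ^ k, by positivity, fun f ε => ?_⟩
  have hε := ε.2.1
  refine SchwartzMap.seminorm_le_bound ℂ k l _ (by positivity) fun x => ?_
  set B := ((Finset.Iic (k, q + 1 + l)).sup fun p => SchwartzMap.seminorm ℂ p.1 p.2) f with hB
  set D := (∫ y, (1 + ‖y‖) ^ (k + (q + 1)) * ‖φ y‖) with hD
  have hD0 : 0 ≤ D := by positivity
  have hbd : ‖iteratedFDeriv ℝ l (conv (dilate φ ε) f - f : 𝓢(Rn n, ℂ)) x‖ ≤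
      D * 2 ^ k * (ε : ℝ) ^ (q + 1) * B / (1 + ‖x‖) ^ k := by
    refine ContinuousMultilinearMap.opNorm_le_bound (by positivity) fun v => ?_
    have e : (∂^{v} (conv (dilate φ ε) f - f : 𝓢(Rn n, ℂ)) : 𝓢(Rn n, ℂ)) =
        conv (dilate φ ε) (∂^{v} f : 𝓢(Rn n, ℂ)) - (∂^{v} f : 𝓢(Rn n, ℂ)) := by
      rw [← iteratedLineDeriv_conv, sub_eq_add_neg, LineDeriv.iteratedLineDerivOp_add,
        LineDeriv.iteratedLineDerivOp_neg, sub_eq_add_neg]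
    rw [← SchwartzMap.iteratedLineDerivOp_eq_iteratedFDeriv, e, div_mul_eq_mul_div,
      le_div_iff₀ (by positivity), mul_comm]
    refine (hφ.norm_conv_dilate_sub_le k q (∂^{v} f : 𝓢(Rn n, ℂ)) ε
      (A := (∏ i, ‖v i‖) * (2 ^ k * B)) (fun z => ?_) x).trans_eq (by ring)
    calc _ ≤ (1 + ‖z‖) ^ k * ((∏ i, ‖v i‖) * ‖iteratedFDeriv ℝ (q + 1 + l) f z‖) := by
          gcongr; exact norm_iteratedFDeriv_iteratedLineDeriv v f _ z
      _ = (∏ i, ‖v i‖) * ((1 + ‖z‖) ^ k * ‖iteratedFDeriv ℝ (q + 1 + l) f z‖) := by ring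
      _ ≤ _ := by
          refine mul_le_mul_of_nonneg_left ?_ (by positivity)
          exact SchwartzMap.one_add_le_sup_seminorm_apply (𝕜 := ℂ)
            (m := (k, q + 1 + l)) le_rfl le_rfl f z
  calc _ ≤ (1 + ‖x‖) ^ k * (D * 2 ^ k * (ε : ℝ) ^ (q + 1) * B / (1 + ‖x‖) ^ k) := by
        gcongr; linarith
    _ = _ := by field_simp

/-! ### Tempered distributions commute with integrals of translates -/

/-- The bound makes `w` vanish on `ker J`, so it descends to a bounded functional on `range J`,
which Hahn–Banach extends. -/
theorem exists_dual_comp_eq {V X : Type*} [AddCommGroup V] [Module ℂ V] [NormedAddCommGroup X]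
    [NormedSpace ℂ X] (J : V →ₗ[ℂ] X) (w : V →ₗ[ℂ] ℂ) (C : ℝ) (h : ∀ v, ‖w v‖ ≤ C * ‖J v‖) :
    ∃ L : X →L[ℂ] ℂ, ∀ v, L (J v) = w v := by
  have hk : LinearMap.ker J ≤ LinearMap.ker w := fun v hv => by
    have := h v
    rw [LinearMap.mem_ker.1 hv, norm_zero, mul_zero] at this
    exact norm_le_zero_iff.1 this
  set f : LinearMap.range J →ₗ[ℂ] ℂ :=
    (LinearMap.ker J).liftQ w hk ∘ₗ J.quotKerEquivRange.symm.toLinearMap with hf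
  have hfv : ∀ v, f ⟨J v, LinearMap.mem_range_self J v⟩ = w v := fun v => by
    have : J.quotKerEquivRange.symm ⟨J v, LinearMap.mem_range_self J v⟩ =
        (LinearMap.ker J).mkQ v := by
      rw [LinearEquiv.symm_apply_eq]
      ext
      simp
    rw [hf, LinearMap.comp_apply, LinearEquiv.coe_coe, this]
    simp
  obtain ⟨L, hL, -⟩ := exists_extension_norm_eq (LinearMap.range J) (f.mkContinuous C (by
    rintro ⟨_, v, rfl⟩
    rw [hfv]
    exact h v))
  refine ⟨L, fun v => ?_⟩
  rw [← hfv]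
  exact hL ⟨J v, LinearMap.mem_range_self J v⟩

/-- The indices of the normalized directional derivatives that occur in a finite set of Schwartz
seminorms. -/
structure SeminormIndex (n : ℕ) (s : Finset (ℕ × ℕ)) where
  /-- The seminorm. -/
  seminorm : s
  /-- The point of evaluation. -/
  point : Rn n
  /-- The directions of differentiation. -/
  dir : Fin seminorm.1.2 → Rn n

/-- With the discrete topology every bounded function on the indices is continuous, so the space of
bounded continuous functions is simply `ℓ^∞`. -/
instance (n : ℕ) (s : Finset (ℕ × ℕ)) : TopologicalSpace (SeminormIndex n s) := ⊥

instance (n : ℕ) (s : Finset (ℕ × ℕ)) : DiscreteTopology (SeminormIndex n s) := ⟨rfl⟩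

theorem norm_pow_mul_iteratedFDeriv_apply_le {n : ℕ} (f : 𝓢(Rn n, ℂ)) (k m : ℕ) (y : Rn n)
    (v : Fin m → Rn n) : ‖((‖y‖ ^ k * (∏ i, ‖v i‖)⁻¹ : ℝ) : ℂ) * iteratedFDeriv ℝ m f y v‖ ≤
      SchwartzMap.seminorm ℂ k m f := by
  rw [norm_mul, Complex.norm_real, Real.norm_of_nonneg (by positivity)]
  calc _ ≤ ‖y‖ ^ k * (∏ i, ‖v i‖)⁻¹ * (‖iteratedFDeriv ℝ m f y‖ * ∏ i, ‖v i‖) := by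
        gcongr; exact ContinuousMultilinearMap.le_opNorm _ _
    _ = ‖y‖ ^ k * ‖iteratedFDeriv ℝ m f y‖ * ((∏ i, ‖v i‖)⁻¹ * ∏ i, ‖v i‖) := by ring
    -- The product with its inverse is `1`, or `0` if some `v i` vanishes.
    _ ≤ ‖y‖ ^ k * ‖iteratedFDeriv ℝ m f y‖ * 1 := by gcongr; exact inv_mul_le_one
    _ ≤ _ := by rw [mul_one]; exact SchwartzMap.le_seminorm ℂ _ _ f y

/-- The family of all normalized directional derivatives in a finite set of seminorms. -/
noncomputable def derivFamily (n : ℕ) (s : Finset (ℕ × ℕ)) :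
    𝓢(Rn n, ℂ) →ₗ[ℂ] (SeminormIndex n s →ᵇ ℂ) where
  toFun f := BoundedContinuousFunction.ofNormedAddCommGroupDiscrete
    (fun t => ((‖t.point‖ ^ t.seminorm.1.1 * (∏ i, ‖t.dir i‖)⁻¹ : ℝ) : ℂ) *
      iteratedFDeriv ℝ t.seminorm.1.2 f t.point t.dir)
    (∑ p ∈ s, SchwartzMap.seminorm ℂ p.1 p.2 f) fun t =>
      (norm_pow_mul_iteratedFDeriv_apply_le f _ _ _ _).trans
        (Finset.single_le_sum (f := fun p : ℕ × ℕ => SchwartzMap.seminorm ℂ p.1 p.2 f)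
          (fun p _ => apply_nonneg _ _) t.seminorm.2)
  map_add' f g := by
    ext1 t
    have e : (⇑(f + g) : Rn n → ℂ) = ⇑f + ⇑g := rfl
    simp [e, iteratedFDeriv_add_apply (f.smooth _).contDiffAt (g.smooth _).contDiffAt, mul_add]
  map_smul' c f := by
    ext1 t
    have e : (⇑(c • f) : Rn n → ℂ) = c • ⇑f := rfl
    simp [e, iteratedFDeriv_const_smul_apply (f.smooth _).contDiffAt, mul_left_comm]

theorem derivFamily_apply {n : ℕ} {s : Finset (ℕ × ℕ)} (f : 𝓢(Rn n, ℂ)) (t : SeminormIndex n s) :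
    derivFamily n s f t = ((‖t.point‖ ^ t.seminorm.1.1 * (∏ i, ‖t.dir i‖)⁻¹ : ℝ) : ℂ) *
      iteratedFDeriv ℝ t.seminorm.1.2 f t.point t.dir := rfl

theorem norm_derivFamily_le {n : ℕ} (s : Finset (ℕ × ℕ)) (f : 𝓢(Rn n, ℂ)) :
    ‖derivFamily n s f‖ ≤ ∑ p ∈ s, SchwartzMap.seminorm ℂ p.1 p.2 f := by
  refine (BoundedContinuousFunction.norm_le
    (Finset.sum_nonneg fun p _ => apply_nonneg _ _)).2 fun t => ?_
  exact (norm_pow_mul_iteratedFDeriv_apply_le f _ _ _ _).trans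
    (Finset.single_le_sum (f := fun p : ℕ × ℕ => SchwartzMap.seminorm ℂ p.1 p.2 f)
      (fun p _ => apply_nonneg _ _) t.seminorm.2)

/-- Converse to `norm_derivFamily_le`: the norm of the family controls each seminorm in `s`, hence
any functional bounded by these seminorms. -/
theorem seminorm_le_norm_derivFamily {n : ℕ} {s : Finset (ℕ × ℕ)} {p : ℕ × ℕ} (hp : p ∈ s)
    (f : 𝓢(Rn n, ℂ)) : SchwartzMap.seminorm ℂ p.1 p.2 f ≤ ‖derivFamily n s f‖ := by
  refine SchwartzMap.seminorm_le_bound ℂ _ _ _ (norm_nonneg _) fun y => ?_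
  rw [← norm_norm y, ← norm_pow, ← norm_smul]
  refine ContinuousMultilinearMap.opNorm_le_bound (norm_nonneg _) fun v => ?_
  by_cases hv : ∃ i, v i = 0
  · obtain ⟨i, hi⟩ := hv
    rw [ContinuousMultilinearMap.map_coord_zero _ i hi, norm_zero]
    positivity
  · push Not at hv
    have hpos : 0 < ∏ i, ‖v i‖ := Finset.prod_pos fun i _ => norm_pos_iff.2 (hv i)
    have := (derivFamily n s f).norm_coe_le_norm ⟨⟨p, hp⟩, y, v⟩
    rw [derivFamily_apply, norm_mul, Complex.norm_real, Real.norm_of_nonneg (by positivity),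
      mul_right_comm, mul_inv_le_iff₀ hpos] at this
    rw [smul_apply, norm_smul, norm_pow, norm_norm]
    exact this

/-- A translation by `h` differs from the identity by the linear term `-∂_{h} R`, of size `O(‖h‖)`,
and the quadratic remainder of `taylor_seminorm`. -/
theorem tendsto_seminorm_reflTrans_sub {n : ℕ} (p : ℕ × ℕ) (ψ : 𝓢(Rn n, ℂ)) (x : Rn n) :
    Tendsto (fun z => SchwartzMap.seminorm ℂ p.1 p.2 (reflTrans z ψ - reflTrans x ψ)) (𝓝 x)
      (𝓝 0) := by
  set R := reflTrans x ψ with hR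
  obtain ⟨K, hK⟩ := taylor_seminorm R p.1 p.2
  set S := SchwartzMap.seminorm ℂ p.1 (p.2 + 1) R
  have hlin : ∀ h : Rn n, SchwartzMap.seminorm ℂ p.1 p.2 (∂_{h} R : 𝓢(Rn n, ℂ)) ≤ ‖h‖ * S := by
    intro h
    refine SchwartzMap.seminorm_le_bound ℂ _ _ _ (by positivity) fun y => ?_
    calc _ ≤ ‖y‖ ^ p.1 * (‖h‖ * ‖iteratedFDeriv ℝ (p.2 + 1) R y‖) := by
          gcongr; exact norm_iteratedFDeriv_lineDeriv h R p.2 y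
      _ = ‖h‖ * (‖y‖ ^ p.1 * ‖iteratedFDeriv ℝ (p.2 + 1) R y‖) := by ring
      _ ≤ _ := by gcongr; exact SchwartzMap.le_seminorm ℂ _ _ R y
  refine squeeze_zero' (g := fun z : Rn n => K * ‖z - x‖ ^ 2 + ‖z - x‖ * S)
    (Eventually.of_forall fun h => apply_nonneg _ _) ?_ ?_
  · filter_upwards [Metric.closedBall_mem_nhds x one_pos] with z hz
    obtain ⟨h, rfl⟩ : ∃ h, z = x + h := ⟨z - x, by abel⟩
    have hh' : ‖h‖ ≤ 1 := by simpa using hz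
    rw [reflTrans_add, ← hR, add_sub_cancel_left]
    have e : SchwartzMap.compSubConstCLM ℂ h R - R =
        (SchwartzMap.compSubConstCLM ℂ h R - R + (∂_{h} R : 𝓢(Rn n, ℂ))) -
          (∂_{h} R : 𝓢(Rn n, ℂ)) := by abel
    rw [e]
    exact (map_sub_le_add _ _ _).trans (add_le_add (hK h hh') (hlin h))
  · have : Continuous fun z : Rn n => K * ‖z - x‖ ^ 2 + ‖z - x‖ * S := by fun_prop
    simpa using this.tendsto x

theorem continuous_derivFamily_reflTrans {n : ℕ} (s : Finset (ℕ × ℕ)) (ψ : 𝓢(Rn n, ℂ)) :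
    Continuous fun x => derivFamily n s (reflTrans x ψ) := by
  rw [continuous_iff_continuousAt]
  intro x
  rw [ContinuousAt, tendsto_iff_norm_sub_tendsto_zero]
  refine squeeze_zero (fun z => norm_nonneg _) (fun z => ?_)
    (by simpa using tendsto_finsetSum s fun p _ => tendsto_seminorm_reflTrans_sub p ψ x)
  rw [← map_sub]
  exact norm_derivFamily_le s _

theorem exists_seminorm_reflTrans_le {n : ℕ} (ψ : 𝓢(Rn n, ℂ)) (p : ℕ × ℕ) :
    ∃ K : ℝ, ∀ x, SchwartzMap.seminorm ℂ p.1 p.2 (reflTrans x ψ) ≤ (1 + ‖x‖) ^ p.1 * K :=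
  ⟨_, seminorm_reflTrans ψ p.1 p.2 _ fun z => SchwartzMap.one_add_le_sup_seminorm_apply (𝕜 := ℂ)
    (m := p) le_rfl le_rfl ψ z⟩

theorem iteratedLineDeriv_reflTrans {n l : ℕ} (x : Rn n) (v : Fin l → Rn n) (ψ : 𝓢(Rn n, ℂ)) :
    (∂^{v} (reflTrans x ψ) : 𝓢(Rn n, ℂ)) =
      (-1 : ℝ) ^ l • reflTrans x (∂^{v} ψ : 𝓢(Rn n, ℂ)) := by
  induction l with
  | zero => simp
  | succ l ih =>
    rw [LineDeriv.iteratedLineDerivOp_succ_left, LineDeriv.iteratedLineDerivOp_succ_left, ih,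
      LineDeriv.lineDerivOp_smul, lineDeriv_reflTrans, pow_succ]
    simp

/-- The scalar form of the exchange: it identifies each coordinate of the Bochner integral in
`integral_mul_convolution`. -/
theorem integral_mul_iteratedLineDeriv_reflTrans {n l : ℕ} (g ψ : 𝓢(Rn n, ℂ)) (v : Fin l → Rn n)
    (y : Rn n) : ∫ x, g x * (∂^{v} (reflTrans x ψ) : 𝓢(Rn n, ℂ)) y =
      (∂^{v} (conv g (reflTrans 0 ψ)) : 𝓢(Rn n, ℂ)) y := by
  rw [iteratedLineDeriv_conv, conv_apply]
  simp_rw [iteratedLineDeriv_reflTrans]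
  simp [reflTrans_apply]

/-- Write `w` as a continuous functional `L` on the Banach space of derivative families. The
translates of `ψ` weighted by `g` are Bochner integrable there, so `L` commutes with the integral.
-/
theorem integral_mul_convolution {n : ℕ} (w : 𝓢'(Rn n, ℂ)) (g ψ : 𝓢(Rn n, ℂ)) :
    ∫ x, g x * w (reflTrans x ψ) = w (conv g (reflTrans 0 ψ)) := by
  obtain ⟨s, C, hC, hb⟩ := exists_seminorm_bound w
  -- Each of the `s.card` seminorms is at most the norm of the family.
  obtain ⟨L, hL⟩ := exists_dual_comp_eq (derivFamily n s) (w : 𝓢(Rn n, ℂ) →ₗ[ℂ] ℂ) (C * s.card)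
    fun f => by
      refine (hb f).trans ?_
      rw [mul_assoc, ← nsmul_eq_mul, ← Finset.sum_const]
      gcongr with p hp
      exact seminorm_le_norm_derivFamily hp f
  have hw : ∀ f, w f = L (derivFamily n s f) := fun f => (hL f).symm
  choose K hK using exists_seminorm_reflTrans_le ψ
  have hint : Integrable fun x => g x • derivFamily n s (reflTrans x ψ) := by
    refine (integrable_finsetSum s fun p _ =>
      (integrable_one_add_norm_pow_mul g p.1).mul_const (K p)).mono'
        (g.continuous.smul (continuous_derivFamily_reflTrans s ψ)).aestronglyMeasurable
        (ae_of_all _ fun x => ?_)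
    have e : ∀ p : ℕ × ℕ, (1 + ‖x‖) ^ p.1 * ‖g x‖ * K p =
        ‖g x‖ * ((1 + ‖x‖) ^ p.1 * K p) := fun p => by ring
    simp_rw [e]
    rw [norm_smul, ← Finset.mul_sum]
    gcongr
    exact (norm_derivFamily_le s _).trans (Finset.sum_le_sum fun p _ => hK p x)
  have hI : ∫ x, g x • derivFamily n s (reflTrans x ψ) =
      derivFamily n s (conv g (reflTrans 0 ψ)) := by
    ext t
    refine ((BoundedContinuousFunction.evalCLM ℂ t).integral_comp_comm hint).symm.trans ?_
    rw [derivFamily_apply, ← SchwartzMap.iteratedLineDerivOp_eq_iteratedFDeriv,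
      ← integral_mul_iteratedLineDeriv_reflTrans, ← integral_const_mul]
    refine integral_congr_ae (ae_of_all _ fun x => ?_)
    change g x * derivFamily n s (reflTrans x ψ) t = _
    rw [derivFamily_apply, ← SchwartzMap.iteratedLineDerivOp_eq_iteratedFDeriv]
    ring
  rw [hw, ← hI, ← L.integral_comp_comm hint]
  refine integral_congr_ae (ae_of_all _ fun x => ?_)
  simp [hw]

/-! ### Regularizations of a tempered distribution -/

/-- Needed because moving the regularization from `w` to the test function reflects the mollifier. A
monomial only changes by a sign under `x ↦ -x`. -/
theorem IsMollifier.refl {n : ℕ} {φ : 𝓢(Rn n, ℂ)} (hφ : IsMollifier φ) :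
    IsMollifier (reflTrans 0 φ) where
  integral_eq_one := by
    simp_rw [reflTrans_apply, zero_sub]
    rw [integral_neg_eq_self (fun x => φ x), hφ.integral_eq_one]
  moment_eq_zero α hα := by
    have e : ∀ x : Rn n, (monomial α x : ℂ) * reflTrans 0 φ x =
        (-1) ^ (∑ i, α i) * ((monomial α (-x) : ℂ) * φ (-x)) := by
      intro x
      have : (monomial α x : ℂ) = (-1) ^ (∑ i, α i) * (monomial α (-x) : ℂ) := by
        simp only [monomial, PiLp.neg_apply, Complex.ofReal_prod, Complex.ofReal_pow,
          Complex.ofReal_neg]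
        rw [← Finset.prod_pow_eq_pow_sum, ← Finset.prod_mul_distrib]
        exact Finset.prod_congr rfl fun i _ => by rw [← mul_pow]; ring
      rw [this, reflTrans_apply, zero_sub, mul_assoc]
    simp_rw [e]
    rw [integral_const_mul, integral_neg_eq_self (fun x => (monomial α x : ℂ) * φ x),
      hφ.moment_eq_zero α hα, mul_zero]

theorem reflTrans_zero_dilate {n : ℕ} (φ : 𝓢(Rn n, ℂ)) (ε : Set.Ioc (0 : ℝ) 1) :
    reflTrans 0 (dilate φ ε) = dilate (reflTrans 0 φ) ε := by
  ext x
  simp [reflTrans_apply, dilate_apply]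

theorem IsMollifier.exists_norm_integral_convNet_sub_le {n : ℕ} {φ : 𝓢(Rn n, ℂ)}
    (hφ : IsMollifier φ) (w : 𝓢'(Rn n, ℂ)) (g : 𝓢(Rn n, ℂ)) :
    ∃ C : ℝ, ∀ ε : Set.Ioc (0 : ℝ) 1, ‖(∫ x, g x * convNet φ w ε x) - w g‖ ≤ C * ε := by
  obtain ⟨s, C, hC, hb⟩ := exists_seminorm_bound w
  -- Order `q = 0`, that is, a rate of one power of `ε`, suffices for weak convergence.
  choose K _ hK using fun p : ℕ × ℕ => hφ.refl.exists_seminorm_conv_dilate_sub_le p.1 p.2 0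
  refine ⟨C * ∑ p ∈ s, K p * ((Finset.Iic (p.1, 0 + 1 + p.2)).sup
    fun p => SchwartzMap.seminorm ℂ p.1 p.2) g, fun ε => ?_⟩
  have e : (∫ x, g x * convNet φ w ε x) = w (conv g (reflTrans 0 (dilate φ ε))) :=
    integral_mul_convolution w g (dilate φ ε)
  rw [e, ← map_sub, reflTrans_zero_dilate, conv_comm, mul_assoc, Finset.sum_mul]
  refine (hb _).trans ?_
  gcongr with p hp
  refine (hK p g ε).trans_eq ?_
  rw [zero_add, pow_one]
  ring

theorem conv_reflTrans {n : ℕ} (f g : 𝓢(Rn n, ℂ)) (x : Rn n) :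
    conv (reflTrans x f) (reflTrans 0 g) = reflTrans x (conv g f) := by
  ext y
  rw [reflTrans_apply, conv_apply, conv_apply,
    ← integral_add_right_eq_self (fun t => reflTrans x f t * reflTrans 0 g (y - t)) y]
  refine integral_congr_ae (ae_of_all _ fun t => ?_)
  simp only [reflTrans_apply]
  rw [mul_comm]
  congr 2 <;> abel

/-- Associativity `g * (w * f) = w * (f * g)`, obtained from `integral_mul_convolution` with a
reflected translate of `g` as test function. -/
theorem conv_convolution_apply {n : ℕ} (w : 𝓢'(Rn n, ℂ)) (f g F : 𝓢(Rn n, ℂ))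
    (hF : ∀ x, F x = w (reflTrans x f)) (x : Rn n) :
    conv g F x = w (reflTrans x (conv f g)) := by
  rw [conv_comm, conv_apply, ← conv_reflTrans, ← integral_mul_convolution]
  refine integral_congr_ae (ae_of_all _ fun t => ?_)
  simp only
  rw [hF, reflTrans_apply, mul_comm]

theorem conv_convolution_comm {n : ℕ} (w : 𝓢'(Rn n, ℂ)) (f g F G : 𝓢(Rn n, ℂ))
    (hF : ∀ x, F x = w (reflTrans x f)) (hG : ∀ x, G x = w (reflTrans x g)) :
    conv g F = conv f G := by
  ext x
  rw [conv_convolution_apply w f g F hF, conv_convolution_apply w g f G hG, conv_comm]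

/-! ### Monomial bounds and Schwartz seminorms -/

theorem norm_monomial_mul_listDeriv_le {n : ℕ} (f : 𝓢(Rn n, ℂ)) (α : Fin n → ℕ)
    (l : List (Fin n)) (x : Rn n) : ‖(monomial α x : ℂ) * listDeriv l f x‖ ≤
      SchwartzMap.seminorm ℂ (∑ i, α i) l.length f := by
  rw [listDeriv_schwartz, norm_mul]
  refine le_trans ?_ (SchwartzMap.le_seminorm ℂ _ _ f x)
  gcongr
  · exact norm_monomial_le α x
  · have := norm_iteratedFDeriv_listDerivS l f 0 x
    rwa [norm_iteratedFDeriv_zero, zero_add] at this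

theorem isNegligible_of_seminorm_le {n : ℕ} (F : Set.Ioc (0 : ℝ) 1 → 𝓢(Rn n, ℂ))
    (h : ∀ k m q : ℕ, ∃ C : ℝ, ∀ ε : Set.Ioc (0 : ℝ) 1,
      SchwartzMap.seminorm ℂ k m (F ε) ≤ C * (ε : ℝ) ^ q) :
    Net.IsNegligible (fun ε => ⇑(F ε) : Net n) := by
  rw [isNegligible_iff]
  refine ⟨fun ε => (F ε).smooth ⊤, fun l α q => ?_⟩
  obtain ⟨C, hC⟩ := h (∑ i, α i) l.length q
  refine ⟨C, fun ε x => ?_⟩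
  have hε := ε.2.1
  rw [inv_mul_le_iff₀ (by positivity), mul_comm _ C]
  exact (norm_monomial_mul_listDeriv_le _ _ _ _).trans (hC ε)

theorem isRegular_const {n : ℕ} (f : 𝓢(Rn n, ℂ)) : Net.IsRegular (fun _ => ⇑f : Net n) := by
  refine ⟨fun _ => f.smooth ⊤, 0, fun α β => ?_⟩
  simp_rw [pow_zero, one_mul, multiDeriv_eq_listDeriv]
  exact ⟨_, fun _ x => norm_monomial_mul_listDeriv_le f α _ x⟩

/-- Links the partial derivatives in the definition of nets to the Fréchet derivatives in the
Schwartz seminorms. -/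
theorem iteratedFDeriv_single {n m : ℕ} {f : Rn n → ℂ} (hf : ContDiff ℝ ∞ f)
    (s : Fin m → Fin n) (x : Rn n) :
    iteratedFDeriv ℝ m f x (fun i => EuclideanSpace.single (s i) 1) =
      listDeriv (List.ofFn s) f x := by
  induction m generalizing x with
  | zero => simp [listDeriv]
  | succ m ih =>
    rw [List.ofFn_succ]
    change _ = partialDeriv (s 0) (listDeriv (List.ofFn fun i => s i.succ) f) x
    rw [partialDeriv_eq _ (contDiff_listDeriv _ hf), iteratedFDeriv_succ_apply_left,
      ← funext (ih fun i => s i.succ)]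
    beta_reduce
    rw [fderiv_continuousMultilinear_apply_const]
    · rfl
    · exact hf.differentiable_iteratedFDeriv (mod_cast ENat.natCast_lt_top m) x

theorem opNorm_le_sum_single {n m : ℕ} (M : ContinuousMultilinearMap ℝ (fun _ : Fin m => Rn n) ℂ) :
    ‖M‖ ≤ ∑ s : Fin m → Fin n, ‖M (fun i => EuclideanSpace.single (s i) 1)‖ := by
  refine ContinuousMultilinearMap.opNorm_le_bound (by positivity) fun v => ?_
  have hv : v = fun i => ∑ j, v i j • (EuclideanSpace.single j 1 : Rn n) := by
    ext1 i
    have := (EuclideanSpace.basisFun (Fin n) ℝ).sum_repr (v i)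
    simpa using this.symm
  conv_lhs => rw [hv]
  rw [ContinuousMultilinearMap.map_sum, Finset.sum_mul]
  refine norm_sum_le_of_le _ fun s _ => ?_
  rw [ContinuousMultilinearMap.map_smul_univ, norm_smul, norm_prod, mul_comm]
  gcongr with i
  exact PiLp.norm_apply_le (v i) (s i)

theorem norm_pow_le_sum_monomial {n : ℕ} (k : ℕ) (x : Rn n) : ‖x‖ ^ k ≤ ∑ s : Fin k → Fin n,
    ‖(monomial (fun j => (Finset.univ.filter fun i => s i = j).card) x : ℂ)‖ := by
  have hx : ‖x‖ ≤ ∑ j, ‖x j‖ := by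
    have := (EuclideanSpace.basisFun (Fin n) ℝ).sum_repr x
    rw [← this]
    refine (norm_sum_le _ _).trans_eq (Finset.sum_congr rfl fun j _ => ?_)
    rw [this]
    simp [norm_smul]
  calc ‖x‖ ^ k ≤ (∑ j, ‖x j‖) ^ k := by gcongr
    _ = ∏ _i : Fin k, ∑ j, ‖x j‖ := by simp
    _ = ∑ s : Fin k → Fin n, ∏ i, ‖x (s i)‖ := by
        rw [Finset.prod_univ_sum, Fintype.piFinset_univ]
    _ = _ := by
        refine Finset.sum_congr rfl fun s _ => ?_
        rw [Complex.norm_real, monomial_card_fiber, norm_prod]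

theorem norm_pow_mul_iteratedFDeriv_le_sum {n : ℕ} {f : Rn n → ℂ} (hf : ContDiff ℝ ∞ f)
    (k m : ℕ) (x : Rn n) : ‖x‖ ^ k * ‖iteratedFDeriv ℝ m f x‖ ≤
      ∑ s : Fin k → Fin n, ∑ r : Fin m → Fin n,
        ‖(monomial (fun j => (Finset.univ.filter fun i => s i = j).card) x : ℂ) *
          listDeriv (List.ofFn r) f x‖ := by
  simp_rw [norm_mul, ← iteratedFDeriv_single hf]
  rw [← Finset.sum_mul_sum]
  gcongr
  · exact norm_pow_le_sum_monomial k x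
  · exact opNorm_le_sum_single _

/-- Each Schwartz seminorm is dominated by a finite sum of the coordinate quantities, so the
exponent `N` stays common to all seminorms. -/
theorem Net.IsRegular.exists_schwartz {n : ℕ} {v : Net n} (hv : v.IsRegular) :
    ∃ (F : Set.Ioc (0 : ℝ) 1 → 𝓢(Rn n, ℂ)) (N : ℕ), (∀ ε, ⇑(F ε) = v ε) ∧
      ∀ k m : ℕ, ∃ C : ℝ, ∀ ε : Set.Ioc (0 : ℝ) 1,
        (ε : ℝ) ^ N * SchwartzMap.seminorm ℂ k m (F ε) ≤ C := by
  obtain ⟨hs, N, h⟩ := hv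
  have h' := (forall_multiDeriv_iff hs fun u : Net n => ∀ α : Fin n → ℕ, ∃ C : ℝ,
    ∀ (ε : Set.Ioc (0 : ℝ) 1) (x : Rn n), (ε : ℝ) ^ N * ‖monomial α x * u ε x‖ ≤ C).1
      fun β α => h α β
  choose C hC using h'
  set D : ℕ → ℕ → ℝ := fun k m => ∑ s : Fin k → Fin n, ∑ r : Fin m → Fin n,
    C (List.ofFn r) (fun j => (Finset.univ.filter fun i => s i = j).card)
  have hD : ∀ (k m : ℕ) (ε : Set.Ioc (0 : ℝ) 1) (x : Rn n),
      (ε : ℝ) ^ N * (‖x‖ ^ k * ‖iteratedFDeriv ℝ m (v ε) x‖) ≤ D k m := by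
    intro k m ε x
    have hε := ε.2.1
    calc _ ≤ (ε : ℝ) ^ N * _ := mul_le_mul_of_nonneg_left
          (norm_pow_mul_iteratedFDeriv_le_sum (hs ε) k m x) (by positivity)
      _ ≤ _ := by
          simp_rw [Finset.mul_sum]
          exact Finset.sum_le_sum fun s _ => Finset.sum_le_sum fun r _ => hC _ _ ε x
  have hD' : ∀ (k m : ℕ) (ε : Set.Ioc (0 : ℝ) 1) (x : Rn n),
      ‖x‖ ^ k * ‖iteratedFDeriv ℝ m (v ε) x‖ ≤ ((ε : ℝ) ^ N)⁻¹ * D k m := by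
    intro k m ε x
    have hε := ε.2.1
    rw [le_inv_mul_iff₀ (by positivity)]
    exact hD k m ε x
  refine ⟨fun ε => ⟨v ε, hs ε, fun k m => ⟨_, hD' k m ε⟩⟩, N, fun ε => rfl, fun k m =>
    ⟨D k m, fun ε => ?_⟩⟩
  have hε := ε.2.1
  rw [← le_inv_mul_iff₀ (by positivity)]
  refine SchwartzMap.seminorm_le_bound ℂ k m _ ?_ fun x => hD' k m ε x
  exact le_trans (by positivity) (hD' k m ε 0)

/-! ### Limits of Schwartz functions -/

/-- The unweighted bounds justify termwise differentiation of the series; the weighted ones then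
give the decay of the sum. -/
theorem exists_schwartz_hasSum {n : ℕ} (G : ℕ → 𝓢(Rn n, ℂ))
    (hG : ∀ k m : ℕ, ∃ v : ℕ → ℝ, Summable v ∧ ∀ j, SchwartzMap.seminorm ℂ k m (G j) ≤ v j) :
    ∃ f : 𝓢(Rn n, ℂ), ∀ x, HasSum (fun j => G j x) (f x) := by
  choose v hv hGv using hG
  have hb : ∀ (k m j : ℕ) (x : Rn n), ‖x‖ ^ k * ‖iteratedFDeriv ℝ m (G j) x‖ ≤ v k m j :=
    fun k m j x => (SchwartzMap.le_seminorm ℂ k m (G j) x).trans (hGv k m j)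
  have hb0 : ∀ (m j : ℕ) (x : Rn n), ‖iteratedFDeriv ℝ m (G j) x‖ ≤ v 0 m j := fun m j x => by
    simpa using hb 0 m j x
  have hs : ContDiff ℝ ∞ fun x => ∑' j, G j x :=
    contDiff_tsum (fun j => (G j).smooth ⊤) (fun m _ => hv 0 m) fun m j x _ => hb0 m j x
  refine ⟨⟨fun x => ∑' j, G j x, hs, fun k m => ⟨∑' j, v k m j, fun x => ?_⟩⟩, fun x => ?_⟩
  · rw [iteratedFDeriv_tsum_apply (N := ⊤) (fun j => (G j).smooth ⊤) (fun m _ => hv 0 m)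
      (fun m j x _ => hb0 m j x) (mod_cast le_top)]
    have h1 : Summable fun j => ‖iteratedFDeriv ℝ m (G j) x‖ :=
      Summable.of_nonneg_of_le (fun _ => norm_nonneg _) (fun j => hb0 m j x) (hv 0 m)
    calc _ ≤ ‖x‖ ^ k * ∑' j, ‖iteratedFDeriv ℝ m (G j) x‖ := by
          gcongr; exact norm_tsum_le_tsum_norm h1
      _ = ∑' j, ‖x‖ ^ k * ‖iteratedFDeriv ℝ m (G j) x‖ := tsum_mul_left.symm
      _ ≤ _ := (h1.mul_left _).tsum_le_tsum (fun j => hb k m j x) (hv k m)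
  · refine (Summable.of_norm_bounded (hv 0 0) fun j => ?_).hasSum
    simpa using hb0 0 j x

/-- The limit is the sum of the telescoping series. Its weak form is enough, since it is only
compared with `w` on test functions. -/
theorem exists_schwartz_tendsto_integral {n : ℕ} (F : ℕ → 𝓢(Rn n, ℂ))
    (hF : ∀ k m : ℕ, ∃ v : ℕ → ℝ, Summable v ∧
      ∀ j, SchwartzMap.seminorm ℂ k m (F (j + 1) - F j) ≤ v j) :
    ∃ f : 𝓢(Rn n, ℂ), ∀ g : 𝓢(Rn n, ℂ),
      Tendsto (fun j => ∫ x, g x * F j x) atTop (𝓝 (∫ x, g x * f x)) := by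
  obtain ⟨d, hd⟩ := exists_schwartz_hasSum (fun j => F (j + 1) - F j) hF
  obtain ⟨v, hv, hFv⟩ := hF 0 0
  have htel : ∀ j x, F j x = F 0 x + ∑ i ∈ Finset.range j, (F (i + 1) - F i) x := by
    intro j x
    have := Finset.sum_range_sub (fun i => F i x) j
    simp only [sub_apply, this]
    ring
  have hv0 : ∀ j, 0 ≤ v j := fun j => (apply_nonneg _ _).trans (hFv j)
  refine ⟨F 0 + d, fun g => tendsto_integral_of_dominated_convergence
    (fun x => ‖g x‖ * (SchwartzMap.seminorm ℂ 0 0 (F 0) + ∑' j, v j))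
    (fun j => (g.continuous.mul (F j).continuous).aestronglyMeasurable)
    (g.integrable.norm.mul_const _) (fun j => ae_of_all _ fun x => ?_)
    (ae_of_all _ fun x => ?_)⟩
  · rw [norm_mul, htel]
    gcongr
    refine (norm_add_le _ _).trans (add_le_add (SchwartzMap.norm_le_seminorm ℂ _ x) ?_)
    refine (norm_sum_le_of_le _ fun i _ =>
      (SchwartzMap.norm_le_seminorm ℂ _ x).trans (hFv i)).trans ?_
    exact hv.sum_le_tsum _ fun i _ => hv0 i
  · refine Tendsto.const_mul _ ?_
    exact ((hd x).tendsto_sum_nat.const_add (F 0 x)).congr fun j => (htel j x).symm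

/-! ### The embedding of tempered distributions -/

/-- The dyadic scale `2^{-j}`. -/
noncomputable def dyadic (j : ℕ) : Set.Ioc (0 : ℝ) 1 :=
  ⟨(1 / 2) ^ j, by positivity, pow_le_one₀ (by norm_num) (by norm_num)⟩

theorem tendsto_dyadic : Tendsto (fun j => (dyadic j : ℝ)) atTop (𝓝 0) :=
  tendsto_pow_atTop_nhds_zero_of_lt_one (by norm_num) (by norm_num)

theorem dyadic_succ (j : ℕ) : (dyadic j : ℝ) = 2 * dyadic (j + 1) := by
  simp only [dyadic, pow_succ]
  ring

theorem IsMollifier.tendsto_integral_convNet {n : ℕ} {φ : 𝓢(Rn n, ℂ)} (hφ : IsMollifier φ)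
    (w : 𝓢'(Rn n, ℂ)) (g : 𝓢(Rn n, ℂ)) :
    Tendsto (fun j => ∫ x, g x * convNet φ w (dyadic j) x) atTop (𝓝 (w g)) := by
  obtain ⟨C, hC⟩ := hφ.exists_norm_integral_convNet_sub_le w g
  rw [tendsto_iff_norm_sub_tendsto_zero]
  refine squeeze_zero (fun _ => norm_nonneg _) (fun j => hC (dyadic j)) ?_
  simpa using tendsto_dyadic.const_mul C

theorem mk_eq_mk_iff_isNegligible {n : ℕ} (u v : moderate n) :
    Ideal.Quotient.mk (negligible n) u = Ideal.Quotient.mk (negligible n) v ↔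
      Net.IsNegligible ((u : Net n) - (v : Net n)) := by
  rw [Ideal.Quotient.eq]
  rfl

theorem IsMollifier.embedTempered_injective {n : ℕ} {φ : 𝓢(Rn n, ℂ)} (hφ : IsMollifier φ) :
    Function.Injective (embedTempered φ) := by
  rw [← LinearMap.ker_eq_bot, LinearMap.ker_eq_bot']
  intro w hw
  have hneg : Net.IsNegligible (convNet φ w) := by
    have := (mk_eq_mk_iff_isNegligible ⟨convNet φ w, convNet_isModerate φ w⟩ 0).1
      (hw.trans (map_zero _).symm)
    simpa using this
  -- No derivative, no weight, one power of `ε`.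
  obtain ⟨C, hC⟩ := ((isNegligible_iff _).1 hneg).2 [] 0 1
  have hC' : ∀ (ε : Set.Ioc (0 : ℝ) 1) (x : Rn n), ‖convNet φ w ε x‖ ≤ C * ε := by
    intro ε x
    have hε := ε.2.1
    have := hC ε x
    rw [pow_one, inv_mul_le_iff₀ hε, mul_comm _ C] at this
    simpa [monomial, netDeriv, listDeriv] using this
  ext g
  refine tendsto_nhds_unique (hφ.tendsto_integral_convNet w g) ?_
  rw [zero_apply]
  refine squeeze_zero_norm (a := fun j => (∫ x, ‖g x‖) * (C * dyadic j)) (fun j => ?_) ?_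
  · rw [← integral_mul_const]
    refine norm_integral_le_of_norm_le (g.integrable.norm.mul_const _) (ae_of_all _ fun x => ?_)
    rw [norm_mul]
    gcongr
    exact hC' _ x
  · simpa using (tendsto_dyadic.const_mul C).const_mul (∫ x, ‖g x‖)

theorem IsMollifier.embedTempered_toTempered {n : ℕ} {φ : 𝓢(Rn n, ℂ)} (hφ : IsMollifier φ)
    (f : 𝓢(Rn n, ℂ)) :
    embedTempered φ (SchwartzMap.toTemperedDistributionCLM (Rn n) ℂ volume f) =
      embedSchwartz n f := by
  refine (mk_eq_mk_iff_isNegligible ⟨_, convNet_isModerate φ _⟩ ⟨_, constNet_isModerate f⟩).2 ?_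
  have e : (convNet φ (SchwartzMap.toTemperedDistributionCLM (Rn n) ℂ volume f) -
      fun _ => ⇑f : Net n) = fun ε => ⇑(conv (dilate φ ε) f - f) := by
    ext ε x
    simp only [Pi.sub_apply, sub_apply, convNet, toTempered_reflTrans]
    rw [conv_comm]
  change Net.IsNegligible (convNet φ _ - fun _ => ⇑f)
  rw [e]
  refine isNegligible_of_seminorm_le _ fun k m q => ?_
  obtain ⟨C, hC0, hC⟩ := hφ.exists_seminorm_conv_dilate_sub_le k m q
  refine ⟨C * ((Finset.Iic (k, q + 1 + m)).sup fun p => SchwartzMap.seminorm ℂ p.1 p.2) f,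
    fun ε => (hC f ε).trans ?_⟩
  rw [mul_right_comm]
  have h0 : 0 ≤ ((Finset.Iic (k, q + 1 + m)).sup fun p => SchwartzMap.seminorm ℂ p.1 p.2) f :=
    apply_nonneg _ _
  exact mul_le_mul_of_nonneg_left (pow_le_pow_of_le_one ε.2.1.le ε.2.2 q.le_succ) (by positivity)

/-! ### Regular tempered distributions -/

/-- Regularity passes to all representatives of a class, with the same exponent `N`; negligibility
is used only with `q = 0`. -/
theorem Net.IsRegular.add_isNegligible {n : ℕ} {u v : Net n} (hu : u.IsRegular)
    (hv : v.IsNegligible) : (u + v).IsRegular := by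
  obtain ⟨hus, N, hN⟩ := hu
  refine ⟨fun ε => (hus ε).add (hv.1 ε), N, fun α β => ?_⟩
  obtain ⟨C, hC⟩ := hN α β
  obtain ⟨D, hD⟩ := hv.2 α β 0
  refine ⟨C + D, fun ε x => ?_⟩
  have hε := ε.2.1
  have hDx := hD ε x
  rw [pow_zero, inv_one, one_mul] at hDx
  have e : multiDeriv β ((u + v) ε) x = multiDeriv β (u ε) x + multiDeriv β (v ε) x := by
    simp only [multiDeriv_eq_listDeriv]
    exact congrFun (listDeriv_add _ (hus ε) (hv.1 ε)) x
  rw [e, mul_add]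
  calc _ ≤ (ε : ℝ) ^ N * (‖monomial α x * multiDeriv β (u ε) x‖ +
        ‖monomial α x * multiDeriv β (v ε) x‖) := by gcongr; exact norm_add_le _ _
    _ = (ε : ℝ) ^ N * ‖monomial α x * multiDeriv β (u ε) x‖ +
        (ε : ℝ) ^ N * ‖monomial α x * multiDeriv β (v ε) x‖ := mul_add _ _ _
    _ ≤ _ := add_le_add (hC ε x) ((mul_le_of_le_one_left (norm_nonneg _)
        (pow_le_one₀ hε.le ε.2.2)).trans hDx)

theorem exists_sup_seminorm_le {n N : ℕ} {F : Set.Ioc (0 : ℝ) 1 → 𝓢(Rn n, ℂ)}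
    (hF : ∀ k m : ℕ, ∃ C : ℝ, ∀ ε : Set.Ioc (0 : ℝ) 1,
        (ε : ℝ) ^ N * SchwartzMap.seminorm ℂ k m (F ε) ≤ C) (s : Finset (ℕ × ℕ)) :
    ∃ C : ℝ, 0 ≤ C ∧ ∀ ε : Set.Ioc (0 : ℝ) 1,
      (ε : ℝ) ^ N * (s.sup fun p => SchwartzMap.seminorm ℂ p.1 p.2) (F ε) ≤ C := by
  choose C hC using hF
  -- Any admissible parameter serves to show that the bounds are nonnegative; `dyadic 0` is one.
  have hC0 : ∀ k m, 0 ≤ C k m := fun k m => (mul_nonneg (pow_nonneg (dyadic 0).2.1.le _)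
    (apply_nonneg _ _)).trans (hC k m (dyadic 0))
  refine ⟨∑ p ∈ s, C p.1 p.2, Finset.sum_nonneg fun p _ => hC0 _ _, fun ε => ?_⟩
  have hε := ε.2.1
  rw [← le_inv_mul_iff₀ (by positivity)]
  refine Seminorm.finset_sup_apply_le (mul_nonneg (by positivity)
    (Finset.sum_nonneg fun p _ => hC0 _ _)) fun p hp => ?_
  rw [le_inv_mul_iff₀ (by positivity)]
  exact (hC p.1 p.2 ε).trans
    (Finset.single_le_sum (f := fun p : ℕ × ℕ => C p.1 p.2) (fun p _ => hC0 _ _) hp)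

/-- By `hcomm`, the difference of two regularizations is a difference of two mollification errors.
Taking order `N + 1` in `ε` beats the growth `ε^(-N)` by one power, as consecutive dyadic scales are
comparable. -/
theorem IsMollifier.exists_seminorm_dyadic_sub_le {n N : ℕ} {φ : 𝓢(Rn n, ℂ)} (hφ : IsMollifier φ)
    {F : Set.Ioc (0 : ℝ) 1 → 𝓢(Rn n, ℂ)}
    (hcomm : ∀ ε δ, conv (dilate φ δ) (F ε) = conv (dilate φ ε) (F δ))
    (hF : ∀ k m : ℕ, ∃ C : ℝ, ∀ ε : Set.Ioc (0 : ℝ) 1,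
        (ε : ℝ) ^ N * SchwartzMap.seminorm ℂ k m (F ε) ≤ C) (k m : ℕ) :
    ∃ C : ℝ, ∀ j, SchwartzMap.seminorm ℂ k m (F (dyadic (j + 1)) - F (dyadic j)) ≤
      C * dyadic (j + 1) := by
  obtain ⟨C, hC0, hC⟩ := hφ.exists_seminorm_conv_dilate_sub_le k m N
  obtain ⟨D, hD0, hD⟩ := exists_sup_seminorm_le hF (Finset.Iic (k, N + 1 + m))
  -- The factor `2 ^ (N + 1)` comes from `δ = 2 * ε` in the error at the coarser scale `δ`.
  refine ⟨C * 2 ^ (N + 1) * D + C * D, fun j => ?_⟩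
  set ε := dyadic (j + 1) with hε
  set δ := dyadic j with hδ
  have hδε : (δ : ℝ) = 2 * ε := dyadic_succ j
  have hε0 := ε.2.1
  have hδ0 := δ.2.1
  have e : F ε - F δ = (conv (dilate φ ε) (F δ) - F δ) - (conv (dilate φ δ) (F ε) - F ε) := by
    rw [hcomm ε δ]
    abel
  rw [e]
  refine (map_sub_le_add _ _ _).trans ?_
  set p := ((Finset.Iic (k, N + 1 + m)).sup fun p =>
    SchwartzMap.seminorm ℂ p.1 p.2 : Seminorm ℂ 𝓢(Rn n, ℂ))
  have hεδ : (ε : ℝ) ^ N ≤ (δ : ℝ) ^ N :=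
    pow_le_pow_left₀ hε0.le (by linarith) N
  have hp : 0 ≤ p (F δ) := apply_nonneg _ _
  calc _ ≤ C * (ε : ℝ) ^ (N + 1) * p (F δ) + C * (δ : ℝ) ^ (N + 1) * p (F ε) :=
        add_le_add (hC _ _) (hC _ _)
    _ = C * ((ε : ℝ) ^ N * p (F δ)) * ε + C * 2 ^ (N + 1) * ((ε : ℝ) ^ N * p (F ε)) * ε := by
        rw [hδε, mul_pow]
        ring
    _ ≤ C * D * ε + C * 2 ^ (N + 1) * D * ε := by
        gcongr
        · exact (mul_le_mul_of_nonneg_right hεδ hp).trans (hD δ)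
        · exact hD ε
    _ = _ := by ring

/-- Tested against any `g`, the dyadic regularizations tend both to `∫ g f` and to `w g`. -/
theorem IsMollifier.mem_range_toTempered_of_isRegular {n : ℕ} {φ : 𝓢(Rn n, ℂ)}
    (hφ : IsMollifier φ) {w : 𝓢'(Rn n, ℂ)} (hw : (convNet φ w).IsRegular) :
    ∃ f : 𝓢(Rn n, ℂ), SchwartzMap.toTemperedDistributionCLM (Rn n) ℂ volume f = w := by
  obtain ⟨F, N, hFv, hF⟩ := hw.exists_schwartz
  have hFw : ∀ ε x, F ε x = w (reflTrans x (dilate φ ε)) := fun ε x => congrFun (hFv ε) x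
  have hcomm : ∀ ε δ, conv (dilate φ δ) (F ε) = conv (dilate φ ε) (F δ) := fun ε δ =>
    conv_convolution_comm w _ _ _ _ (hFw ε) (hFw δ)
  obtain ⟨f, hf⟩ := exists_schwartz_tendsto_integral (fun j => F (dyadic j)) fun k m => by
    obtain ⟨C, hC⟩ := hφ.exists_seminorm_dyadic_sub_le hcomm hF k m
    refine ⟨_, Summable.mul_left C ?_, hC⟩
    -- The bound involves the finer scale `dyadic (j + 1)`, hence a geometric series shifted by one.
    exact (summable_nat_add_iff 1).2 (summable_geometric_of_lt_one (by norm_num) (by norm_num))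
  refine ⟨f, ?_⟩
  ext g
  refine (SchwartzMap.toTemperedDistributionCLM_apply_apply volume f g).trans ?_
  refine tendsto_nhds_unique (hf g) ?_
  simp_rw [hFv]
  exact hφ.tendsto_integral_convNet w g

theorem IsMollifier.sRegular_inter_range {n : ℕ} {φ : 𝓢(Rn n, ℂ)} (hφ : IsMollifier φ) :
    sRegular n ∩ Set.range (embedTempered φ) = Set.range (embedSchwartz n) := by
  refine Set.Subset.antisymm ?_ ?_
  · rintro _ ⟨⟨u, hu, hreg⟩, w, rfl⟩
    have hneg := (mk_eq_mk_iff_isNegligible ⟨_, convNet_isModerate φ w⟩ u).1 hu.symm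
    have hw : (convNet φ w).IsRegular := by
      have := hreg.add_isNegligible hneg
      rwa [add_sub_cancel] at this
    obtain ⟨f, rfl⟩ := hφ.mem_range_toTempered_of_isRegular hw
    exact ⟨f, (hφ.embedTempered_toTempered f).symm⟩
  · rintro _ ⟨f, rfl⟩
    exact ⟨⟨⟨_, constNet_isModerate f⟩, rfl, isRegular_const f⟩, _, hφ.embedTempered_toTempered f⟩

end Colombeau

theorem theorem2p1 (n : ℕ) (φ : 𝓢(Colombeau.Rn n, ℂ)) (hφ : Colombeau.IsMollifier φ) :
    Function.Injective (Colombeau.embedTempered φ) ∧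
    (∀ f : 𝓢(Colombeau.Rn n, ℂ),
      Colombeau.embedTempered φ
          (SchwartzMap.toTemperedDistributionCLM (Colombeau.Rn n) ℂ MeasureTheory.volume f) =
        Colombeau.embedSchwartz n f) ∧
    Colombeau.sRegular n ∩ Set.range (Colombeau.embedTempered φ) =
      Set.range (Colombeau.embedSchwartz n) :=
  ⟨hφ.embedTempered_injective, hφ.embedTempered_toTempered, hφ.sRegular_inter_range⟩
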